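/- Let $k\ge 2$ be an integer, let $(M^{2k},g)$ be a smooth pseudo-Riemannian manifold of dimension $n=2k$ (any signature), and use abstract index notation, raising and lowering indices with $g$. Let $\nabla$ be the Levi-Civita connection, let the Riemann tensor be given by $R_{ij}{}^k{}_\ell X^\ell=\nabla_i\nabla_jX^k-\nabla_j\nabla_iX^k$, and set $R_{ij}=R_{ki}{}^k{}_j$, $R=R_k{}^k$. Let $$P_{ij}=\tfrac{1}{n-2}\bigl(R_{ij}-\tfrac{R}{2(n-1)}g_{ij}\bigr),\qquad W_{ijkl}=R_{ijkl}-\bigl(P_{ik}g_{jl}-P_{il}g_{jk}+P_{jl}g_{ik}-P_{jk}g_{il}\bigr),\qquad C_{ijk}=\nabla_iP_{jk}-\nabla_jP_{ik}$$ be the Schouten, Weyl and Cotton tensors. Let $\delta_{i_1\dotsm i_p}^{j_1\dotsm j_p}=\det\bigl(\delta_{i_a}^{j_b}\bigr)_{a,b=1}^p$ be the generalized Kronecker delta. For a tensor $T_{ij}{}^{kl}$ define $$\mathrm{Pf}^{(k)}(T)=\frac{1}{k!}\,\delta_{i_1\dotsm i_{2k}}^{j_1\dotsm j_{2k}}\,T_{j_1j_2}{}^{i_1i_2}\dotsm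 T_{j_{2k-1}j_{2k}}{}^{i_{2k-1}i_{2k}} ,$$ and write $\mathrm{Pf}^{(k)}(\mathrm{Rm})$ and $\mathrm{Pf}^{(k)}(W)$ for its values at $T_{ij}{}^{kl}=R_{ij}{}^{kl}$ and $T_{ij}{}^{kl}=W_{ij}{}^{kl}$. Define the one-form $$\xi_i^{(k)}=\frac{1}{k!}\,\delta_{ii_2\dotsm i_{2k}}^{jj_2\dotsm j_{2k}}\,C_{jj_2}{}^{i_2}W_{j_3j_4}{}^{i_3i_4}\dotsm W_{j_{2k-1}j_{2k}}{}^{i_{2k-1}i_{2k}}+\frac{1}{2nk}\nabla_i\mathrm{Pf}^{(k)}(W)$$ and the tensor $$\bigl(\Omega^{(k)}\bigr)_i^j=\sum_{\ell=0}^{k-1}\frac{4^{k-\ell}}{\ell!\,(k-\ell)}\,\delta_{ii_1\dotsm i_{k+\ell}}^{jj_1\dotsm j_{k+\ell}}\,W_{j_1j_2}{}^{i_1i_2}\dotsm W_{j_{2\ell-1}j_{2\ell}}{}^{i_{2\ell-1}i_{2\ell}}\,P_{j_{2\ell+1}}^{i_{2\ell+1}}\dotsm P_{j_{k+\ell}}^{i_{k+\ell}}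 .$$ Then the tensor field $\Omega^{(k)}_{ij}$ is smooth and symmetric, the tensor field $(\mathrm{tf}\,\Omega^{(k)})_{ij}=\Omega^{(k)}_{ij}-\frac{1}{2k}(\mathrm{tr}\,\Omega^{(k)})\,g_{ij}$ is trace-free, and $$2k\,\xi_i^{(k)}=\nabla^j\bigl(\mathrm{tf}\,\Omega^{(k)}\bigr)_{ij}+\frac{1}{2k}\nabla_i\mathrm{Pf}^{(k)}(\mathrm{Rm}) .$$ -/

import Mathlib

open scoped Manifold ContDiff Matrix

noncomputable section

/-- A smooth pseudo-Riemannian metric (of arbitrary signature) on an `n`-dimensional manifold: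
a smooth field of nondegenerate symmetric bilinear forms on the tangent spaces. -/
structure PseudoRiemannianMetric (n : ℕ) (M : Type*) [TopologicalSpace M]
    [ChartedSpace (EuclideanSpace ℝ (Fin n)) M] [IsManifold (𝓡 n) ∞ M] where
  /-- The bilinear form on each tangent space. -/
  inner (x : M) : TangentSpace (𝓡 n) x →L[ℝ] TangentSpace (𝓡 n) x →L[ℝ] ℝ
  symm (x : M) (v w : TangentSpace (𝓡 n) x) : inner x v w = inner x w v
  nondegenerate (x : M) (v : TangentSpace (𝓡 n) x) (h : ∀ w, inner x v w = 0) : v = 0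
  contMDiff : ContMDiff (𝓡 n) ((𝓡 n).prod 𝓘(ℝ, EuclideanSpace ℝ (Fin n) →L[ℝ]
      EuclideanSpace ℝ (Fin n) →L[ℝ] ℝ)) ∞
    (fun x ↦ Bundle.TotalSpace.mk' (EuclideanSpace ℝ (Fin n) →L[ℝ]
      EuclideanSpace ℝ (Fin n) →L[ℝ] ℝ) x (inner x))

/-- The components `g_{ij}` of the metric in a chart `e`, as functions of the coordinates
(meaningful on `e.target`): `g_{ij} = g(∂_i, ∂_j)`. -/
def PseudoRiemannianMetric.inChart {n : ℕ} {M : Type*} [TopologicalSpace M]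
    [ChartedSpace (EuclideanSpace ℝ (Fin n)) M] [IsManifold (𝓡 n) ∞ M]
    (g : PseudoRiemannianMetric n M) (e : OpenPartialHomeomorph M (EuclideanSpace ℝ (Fin n)))
    (y : EuclideanSpace ℝ (Fin n)) : Matrix (Fin n) (Fin n) ℝ :=
  Matrix.of fun i j ↦ g.inner (e.symm y)
    (mfderiv (𝓡 n) (𝓡 n) e.symm y (EuclideanSpace.single i (1 : ℝ)))
    (mfderiv (𝓡 n) (𝓡 n) e.symm y (EuclideanSpace.single j (1 : ℝ)))

/-! ### Tensor calculus in local coordinates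

Throughout, `g y` is the matrix of components `g_{ij}` of the metric at the coordinate point `y`,
its inverse matrix has the components `g^{ij}`. All tensors are given by their components. -/

namespace Coord

variable {n : ℕ}

/-- The partial derivative `∂_i f`. For a scalar function this is also `∇_i f`. -/
def pd (i : Fin n) (f : EuclideanSpace ℝ (Fin n) → ℝ) (y : EuclideanSpace ℝ (Fin n)) : ℝ :=
  fderiv ℝ f y (EuclideanSpace.single i (1 : ℝ))

/-- The generalized Kronecker delta, the determinant of the matrix of the Kronecker deltas
`δ_{lower a}^{upper b}`. The slots `a, b` are indexed by an arbitrary finite type `ι`; the value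
does not depend on an ordering of the slots, because lower and upper indices are permuted
simultaneously. -/
def delta {ι : Type} [Fintype ι] [DecidableEq ι] (lower upper : ι → Fin n) : ℝ :=
  (Matrix.of fun a b : ι ↦ if lower a = upper b then (1 : ℝ) else 0).det

variable (g : EuclideanSpace ℝ (Fin n) → Matrix (Fin n) (Fin n) ℝ)

/-- The Christoffel symbols `Γ^k_{ij}` of the Levi-Civita connection. -/
def christoffel (k i j : Fin n) (y : EuclideanSpace ℝ (Fin n)) : ℝ :=
  1 / 2 * ∑ l, (g y)⁻¹ k l *
    (pd i (fun z ↦ g z j l) y + pd j (fun z ↦ g z i l) y - pd l (fun z ↦ g z i j) y)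

/-- `cov2 g T a i j = ∇_a T_{ij}`. -/
def cov2 (T : Fin n → Fin n → EuclideanSpace ℝ (Fin n) → ℝ) (a i j : Fin n)
    (y : EuclideanSpace ℝ (Fin n)) : ℝ :=
  pd a (T i j) y - ∑ m, christoffel g m a i y * T m j y - ∑ m, christoffel g m a j y * T i m y

/-- `div2 g T i = ∇^j T_{ij}`. -/
def div2 (T : Fin n → Fin n → EuclideanSpace ℝ (Fin n) → ℝ) (i : Fin n)
    (y : EuclideanSpace ℝ (Fin n)) : ℝ :=
  ∑ j, ∑ a, (g y)⁻¹ j a * cov2 g T a i j y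

/-- The Riemann tensor `riem g i j k l = R_{ij}{}^k{}_l`, where
`R_{ij}{}^k{}_l X^l = ∇_i ∇_j X^k - ∇_j ∇_i X^k`. -/
def riem (i j k l : Fin n) (y : EuclideanSpace ℝ (Fin n)) : ℝ :=
  pd i (christoffel g k j l) y - pd j (christoffel g k i l) y
    + ∑ m, christoffel g k i m y * christoffel g m j l y
    - ∑ m, christoffel g k j m y * christoffel g m i l y

/-- `riemLow g i j k l = R_{ijkl}`. -/
def riemLow (i j k l : Fin n) (y : EuclideanSpace ℝ (Fin n)) : ℝ :=
  ∑ m, g y k m * riem g i j m l y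

/-- The Ricci tensor `R_{ij} = R_{ki}{}^k{}_j`. -/
def ricci (i j : Fin n) (y : EuclideanSpace ℝ (Fin n)) : ℝ :=
  ∑ k, riem g k i k j y

/-- The scalar curvature `R = R_k{}^k`. -/
def scal (y : EuclideanSpace ℝ (Fin n)) : ℝ :=
  ∑ i, ∑ j, (g y)⁻¹ i j * ricci g i j y

/-- The Schouten tensor `P_{ij} = (R_{ij} - J g_{ij}) / (n - 2)`, where `J = R / (2 (n - 1))`. -/
def schouten (i j : Fin n) (y : EuclideanSpace ℝ (Fin n)) : ℝ :=
  1 / ((n : ℝ) - 2) * (ricci g i j y - scal g y / (2 * ((n : ℝ) - 1)) * g y i j)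

/-- The Weyl tensor `W_{ijkl}`. -/
def weylLow (i j k l : Fin n) (y : EuclideanSpace ℝ (Fin n)) : ℝ :=
  riemLow g i j k l y - (schouten g i k y * g y j l - schouten g i l y * g y j k
    + schouten g j l y * g y i k - schouten g j k y * g y i l)

/-- The Cotton tensor `C_{ijk} = ∇_i P_{jk} - ∇_j P_{ik}`. -/
def cotton (i j k : Fin n) (y : EuclideanSpace ℝ (Fin n)) : ℝ :=
  cov2 g (schouten g) i j k y - cov2 g (schouten g) j i k y

/-- Raise the last two indices of a `(0,4)`-tensor: `raise34 g T i j k l = T_{ij}{}^{kl}`. -/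
def raise34 (T : Fin n → Fin n → Fin n → Fin n → EuclideanSpace ℝ (Fin n) → ℝ)
    (i j k l : Fin n) (y : EuclideanSpace ℝ (Fin n)) : ℝ :=
  ∑ p, ∑ q, (g y)⁻¹ k p * (g y)⁻¹ l q * T i j p q y

/-- `schoutenUp g j i = P_j^i`. -/
def schoutenUp (j i : Fin n) (y : EuclideanSpace ℝ (Fin n)) : ℝ :=
  ∑ p, (g y)⁻¹ i p * schouten g j p y

/-- `cottonUp g i j k = C_{ij}{}^k`. -/
def cottonUp (i j k : Fin n) (y : EuclideanSpace ℝ (Fin n)) : ℝ :=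
  ∑ p, (g y)⁻¹ k p * cotton g i j p y

/-- `pf k T = (1 / k!) δ_{i_1 ⋯ i_{2k}}^{j_1 ⋯ j_{2k}} T_{j_1 j_2}{}^{i_1 i_2} ⋯
T_{j_{2k-1} j_{2k}}{}^{i_{2k-1} i_{2k}}`, where `T i j k l = T_{ij}{}^{kl}`. The slot `(a, 0)`
is the slot `2a + 1` of the display, the slot `(a, 1)` is the slot `2a + 2`. -/
def pf (k : ℕ) (T : Fin n → Fin n → Fin n → Fin n → EuclideanSpace ℝ (Fin n) → ℝ)
    (y : EuclideanSpace ℝ (Fin n)) : ℝ :=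
  1 / (k.factorial : ℝ) * ∑ I : Fin k × Fin 2 → Fin n, ∑ J : Fin k × Fin 2 → Fin n,
    delta I J * ∏ a : Fin k, T (J (a, 0)) (J (a, 1)) (I (a, 0)) (I (a, 1)) y

/-- The one-form `ξ_i^{(k)} = (1 / k!) δ_{i i_2 ⋯ i_{2k}}^{j j_2 ⋯ j_{2k}} C_{j j_2}{}^{i_2}
W_{j_3 j_4}{}^{i_3 i_4} ⋯ W_{j_{2k-1} j_{2k}}{}^{i_{2k-1} i_{2k}} + (1 / (2nk)) ∇_i Pf^{(k)}(W)`.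
The first two slots are in `Fin 2`, the slots of the `k - 1` Weyl factors in
`Fin (k - 1) × Fin 2`. -/
def xi (k : ℕ) (i : Fin n) (y : EuclideanSpace ℝ (Fin n)) : ℝ :=
  1 / (k.factorial : ℝ) *
    (∑ j : Fin n, ∑ i₂ : Fin n, ∑ j₂ : Fin n,
      ∑ I : Fin (k - 1) × Fin 2 → Fin n, ∑ J : Fin (k - 1) × Fin 2 → Fin n,
        delta (Sum.elim ![i, i₂] I) (Sum.elim ![j, j₂] J) * cottonUp g j j₂ i₂ y *
          ∏ a : Fin (k - 1), raise34 g (weylLow g) (J (a, 0)) (J (a, 1)) (I (a, 0)) (I (a, 1)) y)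
    + 1 / (2 * (n : ℝ) * (k : ℝ)) * pd i (pf k (raise34 g (weylLow g))) y

/-- The tensor `(Ω^{(k)})_i^j = ∑_{ℓ=0}^{k-1} 4^{k-ℓ} / (ℓ! (k-ℓ))
δ_{i i_1 ⋯ i_{k+ℓ}}^{j j_1 ⋯ j_{k+ℓ}} W_{j_1 j_2}{}^{i_1 i_2} ⋯
W_{j_{2ℓ-1} j_{2ℓ}}{}^{i_{2ℓ-1} i_{2ℓ}} P_{j_{2ℓ+1}}^{i_{2ℓ+1}} ⋯ P_{j_{k+ℓ}}^{i_{k+ℓ}}`.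
The first slot is in `Fin 1`, the slots of the `ℓ` Weyl factors in `Fin ℓ × Fin 2`, and the slots
of the `k - ℓ` Schouten factors in `Fin (k - ℓ)`. -/
def omegaMixed (k : ℕ) (i j : Fin n) (y : EuclideanSpace ℝ (Fin n)) : ℝ :=
  ∑ l ∈ Finset.range k, (4 : ℝ) ^ (k - l) * (1 / ((l.factorial : ℝ) * ((k : ℝ) - (l : ℝ)))) *
    ∑ I : (Fin l × Fin 2) ⊕ Fin (k - l) → Fin n, ∑ J : (Fin l × Fin 2) ⊕ Fin (k - l) → Fin n,
      delta (Sum.elim ![i] I) (Sum.elim ![j] J) *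
        (∏ a : Fin l, raise34 g (weylLow g) (J (Sum.inl (a, 0))) (J (Sum.inl (a, 1)))
          (I (Sum.inl (a, 0))) (I (Sum.inl (a, 1))) y) *
        ∏ b : Fin (k - l), schoutenUp g (J (Sum.inr b)) (I (Sum.inr b)) y

/-- `Ω_{ij}`, the second index of `Ω_i^j` lowered with the metric. -/
def omega (k : ℕ) (i j : Fin n) (y : EuclideanSpace ℝ (Fin n)) : ℝ :=
  ∑ m, omegaMixed g k i m y * g y m j

/-- The trace `g^{ij} T_{ij}`. -/
def trace2 (T : Fin n → Fin n → EuclideanSpace ℝ (Fin n) → ℝ) (y : EuclideanSpace ℝ (Fin n)) : ℝ :=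
  ∑ i, ∑ j, (g y)⁻¹ i j * T i j y

/-- The trace-free part `(tf T)_{ij} = T_{ij} - (1 / n) (tr T) g_{ij}`. -/
def tracefree (T : Fin n → Fin n → EuclideanSpace ℝ (Fin n) → ℝ) (i j : Fin n)
    (y : EuclideanSpace ℝ (Fin n)) : ℝ :=
  T i j y - 1 / (n : ℝ) * trace2 g T y * g y i j

end Coord

end

/-!
The proof reduces the tensor identity to algebra in a polynomial ring, on which the generalized
Kronecker delta is a linear functional. Let `X (i, j)`, with a lower index `i` and an upper index
`j`, be commuting variables, and let `deltaFun` send a monomial `X (i₁, j₁) ⋯ X (iₚ, jₚ)` to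
`δ_{i₁ ⋯ iₚ}^{j₁ ⋯ jₚ}`. A tensor `P_j^i` becomes a linear form `p`, a tensor `W_{jl}{}^{ik}` a
quadratic form `w` (`elt2`, `elt4`), the identity endomorphism the linear form `θ = idElt`, and the
contractions of the delta with products of tensors are the values of `deltaFun` on products of these
forms. Four properties of the functional are used:

* it is antisymmetric in the upper indices (`deltaFun_antisymm`), so that tensor identities which hold
  after antisymmetrization become equations modulo the largest ideal `deltaIdeal` in its kernel;
* `deltaFun (f θ) = (n - p) deltaFun f` for `f` homogeneous of degree `p` (`deltaFun_mul_idElt`);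
* it is invariant under the action `glDer` of the Lie algebra `gl(n)` (`deltaFun_glDer`);
* it is invariant under the exchange of lower and upper indices by means of the metric
  (`deltaFun_metricTranspose`), which gives the symmetry of `Ω` (`sum_deltaFun_mul_symm`).

A covariant derivative is the partial derivative of the coefficients plus `glDer` of the connection
matrix. By `gl(n)`-invariance the covariant derivative of a contraction with the delta is therefore
obtained by differentiating its factors with the Leibniz rule (`covariant_omegaMat`).

The geometric input is the following. Modulo `deltaIdeal`, `Rm = w + 4 p θ` (`deltaMk_riemElt`), so
that in dimension `n = 2k` the binomial theorem gives `Pf(Rm) = Pf(W) + tr Ω` (`pf_riem_eq_add`).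
Write `∇p` and `∇w` for the sums `∑ⱼ X (i, j) ∇_j p` and `∑ⱼ X (i, j) ∇_j w`, and `c` for the quadratic
form of the Cotton tensor. Then `2 ∇p = c` by the definition of the Cotton tensor, and the second
Bianchi identity `∇Rm = 0` yields `∇w = -2 c θ` (`deltaMk_sum_X_mul_covWeylElt`). Inserting this into
the divergence of `Ω`, the sum over `ℓ` telescopes to the contraction of the delta with `c w^{k-1}`
(`sum_deltaFun_X_mul_omegaEltDeriv`), which is the Cotton term of `ξ`. What remains is the gradient of
`Pf(W) = Pf(Rm) - tr Ω`, whose second part is the divergence of the trace part of `Ω`.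

All of this takes place in a chart, where the metric is a smooth function with values in the
nonsingular symmetric matrices (`PseudoRiemannianMetric.isMetricOn_inChart`).
-/

noncomputable section

namespace Coord

open MvPolynomial

variable {n : ℕ}

/-! ### The generalized Kronecker delta -/

section Slots

variable {ι κ : Type} [Fintype ι] [DecidableEq ι] [Fintype κ] [DecidableEq κ]

/-- Relabelling the slots does not change the generalized Kronecker delta. -/
theorem delta_comp_equiv (e : ι ≃ κ) (I J : κ → Fin n) :
    delta (fun a ↦ I (e a)) (fun a ↦ J (e a)) = delta I J := by
  unfold delta
  rw [← Matrix.det_submatrix_equiv_self e (Matrix.of fun a b ↦ if I a = J b then (1 : ℝ) else 0)]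
  rfl

theorem delta_comp_perm_upper (σ : Equiv.Perm ι) (I J : ι → Fin n) :
    delta I (fun a ↦ J (σ a)) = (Equiv.Perm.sign σ : ℤ) * delta I J := by
  unfold delta
  rw [← Matrix.det_permute']
  rfl

theorem delta_swap (I J : ι → Fin n) : delta J I = delta I J := by
  unfold delta
  rw [← Matrix.det_transpose]
  congr 1
  ext a b
  simp [eq_comm]

/-- An extra slot carrying the same index `m` above and below kills the delta if `m` already
occurs, and is invisible otherwise. -/
theorem delta_extend (I J : ι → Fin n) (m : Fin n) :
    delta (Sum.elim I fun _ : Unit ↦ m) (Sum.elim J fun _ : Unit ↦ m) =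
      if m ∈ Finset.univ.image J then 0 else delta I J := by
  split_ifs with h
  · obtain ⟨b, -, hb⟩ := Finset.mem_image.1 h
    unfold delta
    refine Matrix.det_zero_of_column_eq (i := Sum.inl b) (j := Sum.inr ()) (by simp) ?_
    rintro (a | a)
    · change (if I a = J b then (1 : ℝ) else 0) = if I a = m then 1 else 0
      rw [hb]
    · simp [hb]
  · have hJ : ∀ b, m ≠ J b := fun b hb ↦ h (Finset.mem_image.2 ⟨b, Finset.mem_univ _, hb.symm⟩)
    have key : (Matrix.of fun a b : ι ⊕ Unit ↦
        if (Sum.elim I fun _ : Unit ↦ m) a = (Sum.elim J fun _ : Unit ↦ m) b then (1 : ℝ) else 0) =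
        Matrix.fromBlocks (Matrix.of fun a b : ι ↦ if I a = J b then (1 : ℝ) else 0)
          (Matrix.of fun a _ ↦ if I a = m then 1 else 0) 0 1 := by
      ext (a | a) (b | b)
      · rfl
      · rfl
      · simp [hJ]
      · simp
    unfold delta
    rw [key, Matrix.det_fromBlocks_zero₂₁, Matrix.det_one, mul_one]

theorem delta_eq_zero_of_not_injective (I J : ι → Fin n) (h : ¬ Function.Injective J) :
    delta I J = 0 := by
  simp only [Function.Injective, not_forall] at h
  obtain ⟨a, b, hab, hne⟩ := h
  exact Matrix.det_zero_of_column_eq hne fun c ↦ by simp [hab]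

/-- The trace of the delta over one pair of slots. For injective `J`, exactly `n - |ι|` values of the
new index do not occur among the upper indices. -/
theorem sum_delta_extend (I J : ι → Fin n) :
    ∑ m, delta (Sum.elim I fun _ : Unit ↦ m) (Sum.elim J fun _ : Unit ↦ m) =
      ((n : ℝ) - Fintype.card ι) * delta I J := by
  simp only [delta_extend]
  by_cases h : Function.Injective J
  · rw [Finset.sum_ite, Finset.sum_const_zero, zero_add, Finset.sum_const, nsmul_eq_mul,
      Finset.filter_not, Finset.filter_mem_eq_inter, Finset.univ_inter,
      Finset.card_sdiff_of_subset (Finset.subset_univ _), Finset.card_image_of_injective _ h,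
      Finset.card_univ, Finset.card_univ, Fintype.card_fin, Nat.cast_sub]
    simpa using Fintype.card_le_of_injective J h
  · simp [delta_eq_zero_of_not_injective I J h]

/-- Cramer's rule: the delta with one upper index replaced is linear in the replaced column. -/
theorem sum_mul_delta_update_upper (I J : ι → Fin n) (a : ι) (f : Fin n → ℝ) :
    ∑ m, f m * delta I (Function.update J a m) =
      ∑ b, (Matrix.of fun a b : ι ↦ if I a = J b then (1 : ℝ) else 0).adjugate a b * f (I b) := by
  set M := Matrix.of fun a b : ι ↦ if I a = J b then (1 : ℝ) else 0 with hM
  have h : ∀ m, delta I (Function.update J a m) =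
      ∑ b, M.adjugate a b * if I b = m then 1 else 0 := by
    intro m
    have : (Matrix.of fun c b : ι ↦ if I c = Function.update J a m b then (1 : ℝ) else 0) =
        M.updateCol a fun b ↦ if I b = m then 1 else 0 := by
      ext c b
      by_cases hb : b = a
      · subst hb; simp
      · simp [hb, hM]
    unfold delta
    rw [this, ← Matrix.cramer_apply, Matrix.cramer_eq_adjugate_mulVec]
    rfl
  simp only [h, Finset.mul_sum]
  rw [Finset.sum_comm]
  refine Finset.sum_congr rfl fun b _ ↦ ?_
  simp [mul_comm]

theorem sum_mul_delta_update_lower (I J : ι → Fin n) (a : ι) (f : Fin n → ℝ) :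
    ∑ m, f m * delta (Function.update I a m) J =
      ∑ b, (Matrix.of fun a b : ι ↦ if I a = J b then (1 : ℝ) else 0).adjugate b a * f (J b) := by
  simp only [delta_swap J]
  rw [sum_mul_delta_update_upper]
  refine Finset.sum_congr rfl fun b _ ↦ ?_
  rw [← Matrix.transpose_apply (Matrix.adjugate _), Matrix.adjugate_transpose]
  congr 2
  ext c d
  simp [eq_comm]

/-- The generalized Kronecker delta is invariant under the Lie algebra `gl(n)`: acting on the upper
indices and acting on the lower indices give the same double sum over the adjugate matrix. -/
theorem delta_gl_invariant (A : Matrix (Fin n) (Fin n) ℝ) (I J : ι → Fin n) :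
    ∑ a, ∑ m, A (J a) m * delta I (Function.update J a m) =
      ∑ a, ∑ m, A m (I a) * delta (Function.update I a m) J := by
  simp only [sum_mul_delta_update_upper I J _ fun m ↦ A (J _) m,
    sum_mul_delta_update_lower I J _ fun m ↦ A m (I _)]
  exact Finset.sum_comm

/-- The generalized Kronecker delta is unchanged if lower and upper indices are exchanged by
means of a nondegenerate bilinear form and its inverse. -/
theorem delta_metric_transpose (G H : Matrix (Fin n) (Fin n) ℝ) (h : H * Gᵀ = 1)
    (I J : ι → Fin n) :
    ∑ A : ι → Fin n, ∑ B : ι → Fin n, (∏ a, G (I a) (A a)) * (∏ a, H (J a) (B a)) * delta B A =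
      delta I J := by
  have hHG : ∀ i j, ∑ c, G i c * H j c = if j = i then 1 else 0 := by
    intro i j
    have := congr_fun (congr_fun h j) i
    rw [Matrix.mul_apply, Matrix.one_apply] at this
    rw [← this]
    exact Finset.sum_congr rfl fun c _ ↦ mul_comm _ _
  -- each summand of the Leibniz formula for the determinant is preserved separately
  have key : ∀ σ : Equiv.Perm ι,
      ∑ A : ι → Fin n, ∑ B : ι → Fin n, (∏ a, G (I a) (A a)) * (∏ a, H (J a) (B a)) *
        (∏ a, if B (σ a) = A a then (1 : ℝ) else 0) =
      ∏ a, if J (σ a) = I a then (1 : ℝ) else 0 := by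
    intro σ
    have : ∀ A : ι → Fin n, ∑ B : ι → Fin n, (∏ a, G (I a) (A a)) * (∏ a, H (J a) (B a)) *
        (∏ a, if B (σ a) = A a then (1 : ℝ) else 0) = ∏ a, G (I a) (A a) * H (J (σ a)) (A a) := by
      intro A
      rw [Finset.sum_eq_single fun a ↦ A (σ.symm a)]
      · rw [← Equiv.prod_comp σ fun a ↦ H (J a) (A (σ.symm a))]
        simp [Finset.prod_mul_distrib]
      · intro B _ hB
        have : ∃ a, B (σ a) ≠ A a := by
          by_contra! hc
          exact hB (funext fun a ↦ by simpa using hc (σ.symm a))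
        obtain ⟨a, ha⟩ := this
        rw [Finset.prod_eq_zero (f := fun a ↦ if B (σ a) = A a then (1 : ℝ) else 0)
          (Finset.mem_univ a) (by simp [ha]), mul_zero]
      · simp
    rw [Finset.sum_congr rfl fun A _ ↦ this A,
      ← Finset.prod_congr rfl fun a _ ↦ hHG (I a) (J (σ a)), Finset.prod_univ_sum,
      Fintype.piFinset_univ]
  rw [← delta_swap I J]
  simp only [delta, Matrix.det_apply, Matrix.of_apply, Finset.mul_sum]
  rw [Finset.sum_congr rfl fun A _ ↦ Finset.sum_comm, Finset.sum_comm]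
  refine Finset.sum_congr rfl fun σ _ ↦ ?_
  simp only [mul_smul_comm, ← Finset.smul_sum]
  rw [key σ]

end Slots

/-! ### The delta as a functional on polynomials -/

/-- The linear functional `∏ₐ X (iₐ, jₐ) ↦ δ_{i₁ ⋯ iₚ}^{j₁ ⋯ jₚ}` on the polynomial ring in variables
indexed by pairs (lower index, upper index). It is well defined because the delta is invariant
under simultaneous permutations; the slots of a monomial are taken to be the pairs consisting
of a variable and a number below its exponent. -/
def deltaFun (n : ℕ) : MvPolynomial (Fin n × Fin n) ℝ →ₗ[ℝ] ℝ :=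
  (basisMonomials (Fin n × Fin n) ℝ).constr ℝ fun m ↦
    delta (ι := Σ c : Fin n × Fin n, Fin (m c)) (fun a ↦ a.1.1) (fun a ↦ a.1.2)

theorem monomial_one_eq_prod_X {σ : Type} [Fintype σ] (m : σ →₀ ℕ) :
    (monomial m 1 : MvPolynomial σ ℝ) = ∏ a : Σ c, Fin (m c), X a.1 := by
  rw [Fintype.prod_sigma, monomial_eq, C_1, one_mul, Finsupp.prod_fintype _ _ (by simp)]
  simp

/-- The value on a product of variables, with the slots indexed by the factors. -/
theorem deltaFun_prod {ι : Type} [Fintype ι] [DecidableEq ι] (s : ι → Fin n × Fin n) :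
    deltaFun n (∏ a, X (s a)) = delta (fun a ↦ (s a).1) (fun a ↦ (s a).2) := by
  classical
  set m : Fin n × Fin n →₀ ℕ := ∑ a, Finsupp.single (s a) 1 with hm
  -- the fibre of `s` over a variable is as large as the exponent of that variable in the product
  have hmc : ∀ c, Fintype.card {a // s a = c} = m c := by
    intro c
    simp [hm, Finsupp.finsetSum_apply, Finsupp.single_apply, Fintype.card_subtype]
  have h1 : (∏ a, X (s a) : MvPolynomial (Fin n × Fin n) ℝ) = monomial m 1 := by
    simp only [X, hm, monomial_sum_one]
  let e : (Σ c, Fin (m c)) ≃ ι :=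
    (Equiv.sigmaCongrRight fun c ↦ (Fintype.equivFinOfCardEq (hmc c)).symm).trans
      (Equiv.sigmaFiberEquiv s)
  have he : ∀ a, s (e a) = a.1 := fun a ↦
    ((Fintype.equivFinOfCardEq (hmc a.1)).symm a.2).2
  have h2 : (monomial m 1 : MvPolynomial (Fin n × Fin n) ℝ) = basisMonomials _ ℝ m := by
    rw [coe_basisMonomials]
  rw [h1, ← delta_comp_equiv e, deltaFun, h2, Module.Basis.constr_basis]
  simp only [he]

/-- A linear map on the polynomial ring is determined by its values on products of variables. -/
theorem linearMap_ext_prod_X {σ V : Type} [Fintype σ] [DecidableEq σ] [AddCommGroup V] [Module ℝ V]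
    {φ ψ : MvPolynomial σ ℝ →ₗ[ℝ] V}
    (h : ∀ (ι : Type) [Fintype ι] [DecidableEq ι] (s : ι → σ),
      φ (∏ a, X (s a)) = ψ (∏ a, X (s a))) : φ = ψ := by
  refine (basisMonomials σ ℝ).ext fun m ↦ ?_
  rw [coe_basisMonomials]
  beta_reduce
  rw [monomial_one_eq_prod_X]
  exact h _ _

theorem prod_X_mul_X_mul_X {ι : Type} [Fintype ι] (s : ι → Fin n × Fin n) (c d : Fin n × Fin n) :
    ((∏ a, X (s a)) * (X c * X d) : MvPolynomial (Fin n × Fin n) ℝ) =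
      ∏ a : ι ⊕ Fin 2, X (Sum.elim s ![c, d] a) := by
  simp [Fintype.prod_sum_type]

/-- Antisymmetry of the delta in its upper indices. -/
theorem deltaFun_antisymm (f : MvPolynomial (Fin n × Fin n) ℝ) (i j k l : Fin n) :
    deltaFun n (f * (X (i, l) * X (k, j))) = - deltaFun n (f * (X (i, j) * X (k, l))) := by
  suffices (deltaFun n).comp (LinearMap.mulRight ℝ (X (i, l) * X (k, j))) =
      -(deltaFun n).comp (LinearMap.mulRight ℝ (X (i, j) * X (k, l))) from
    LinearMap.congr_fun this f
  refine linearMap_ext_prod_X fun ι _ _ s ↦ ?_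
  simp only [LinearMap.comp_apply, LinearMap.mulRight_apply, LinearMap.neg_apply,
    prod_X_mul_X_mul_X, deltaFun_prod]
  have h := delta_comp_perm_upper (Equiv.swap (Sum.inr 0) (Sum.inr 1))
    (fun a ↦ (Sum.elim s ![(i, j), (k, l)] a).1) (fun a ↦ (Sum.elim s ![(i, j), (k, l)] a).2)
  rw [Equiv.Perm.sign_swap (by simp)] at h
  simp only [Units.val_neg, Units.val_one, Int.cast_neg, Int.cast_one, neg_mul, one_mul] at h
  rw [← h]
  congr 1
  · ext (a | a)
    · rfl
    · fin_cases a <;> rfl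
  · ext (a | a)
    · rw [Equiv.swap_apply_of_ne_of_ne (by simp) (by simp)]; rfl
    · fin_cases a <;> simp

/-- The identity endomorphism as an element of the polynomial ring. -/
def idElt (n : ℕ) : MvPolynomial (Fin n × Fin n) ℝ := ∑ m, X (m, m)

theorem deltaFun_prod_mul_idElt {ι : Type} [Fintype ι] [DecidableEq ι] (s : ι → Fin n × Fin n) :
    deltaFun n ((∏ a, X (s a)) * idElt n) =
      ((n : ℝ) - Fintype.card ι) * deltaFun n (∏ a, X (s a)) := by
  rw [deltaFun_prod, ← sum_delta_extend, idElt, Finset.mul_sum, map_sum]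
  refine Finset.sum_congr rfl fun m _ ↦ ?_
  have : ((∏ a, X (s a)) * X (m, m) : MvPolynomial (Fin n × Fin n) ℝ) =
      ∏ a : ι ⊕ Unit, X (Sum.elim s (fun _ ↦ (m, m)) a) := by
    simp [Fintype.prod_sum_type]
  rw [this, deltaFun_prod]
  congr 1 <;> ext (a | a) <;> rfl

/-- Tracing out a pair of indices of the delta multiplies by `n - p`, where `p` is the number of the
remaining pairs. -/
theorem deltaFun_mul_idElt {f : MvPolynomial (Fin n × Fin n) ℝ} {p : ℕ} (hf : f.IsHomogeneous p) :
    deltaFun n (f * idElt n) = ((n : ℝ) - p) * deltaFun n f := by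
  conv_lhs => rw [f.as_sum]
  conv_rhs => rw [f.as_sum]
  rw [Finset.sum_mul, map_sum, map_sum, Finset.mul_sum]
  refine Finset.sum_congr rfl fun m hm ↦ ?_
  have hdeg : Fintype.card (Σ c, Fin (m c)) = p := by
    have h : m.degree = p :=
      (DFunLike.congr_fun (Finsupp.degree_eq_weight_one (R := ℕ)) m).trans
        (hf (mem_support_iff.1 hm))
    rw [Finsupp.degree_eq_sum] at h
    simpa using h
  have h : (monomial m (coeff m f) : MvPolynomial (Fin n × Fin n) ℝ) =
      coeff m f • ∏ a : Σ c, Fin (m c), X a.1 := by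
    rw [← monomial_one_eq_prod_X, smul_monomial, smul_eq_mul, mul_one]
  rw [h, smul_mul_assoc, map_smul, map_smul, deltaFun_prod_mul_idElt, hdeg, smul_eq_mul,
    smul_eq_mul]
  ring

/-- The action of an endomorphism `A`, with components `A^m_i = A m i`, on the polynomial ring,
where `X (i, j)` transforms like the tensor product of a vector `∂_i` and a covector `dx^j`. -/
def glDer (A : Matrix (Fin n) (Fin n) ℝ) :
    Derivation ℝ (MvPolynomial (Fin n × Fin n) ℝ) (MvPolynomial (Fin n × Fin n) ℝ) :=
  mkDerivation ℝ fun c ↦ ∑ m, (A m c.1 • X (m, c.2) - A c.2 m • X (c.1, m))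

theorem glDer_X (A : Matrix (Fin n) (Fin n) ℝ) (i j : Fin n) :
    glDer A (X (i, j)) = ∑ m, (A m i • X (m, j) - A j m • X (i, m)) :=
  mkDerivation_X _ _ _

theorem derivation_prod {R S ι : Type} [CommRing R] [CommRing S] [Algebra R S] [DecidableEq ι]
    (D : Derivation R S S) (t : Finset ι) (f : ι → S) :
    D (∏ a ∈ t, f a) = ∑ a ∈ t, D (f a) * ∏ b ∈ t.erase a, f b := by
  induction t using Finset.induction_on with
  | empty => simp
  | insert a t ha ih =>
    rw [Finset.prod_insert ha, D.leibniz, ih, Finset.sum_insert ha, Finset.erase_insert ha,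
      smul_eq_mul, smul_eq_mul, Finset.mul_sum, add_comm, mul_comm]
    congr 1
    refine Finset.sum_congr rfl fun b hb ↦ ?_
    rw [Finset.erase_insert_of_ne (by rintro rfl; exact ha hb),
      Finset.prod_insert (fun h ↦ ha (Finset.mem_of_mem_erase h))]
    ring

theorem X_mul_prod_erase {ι σ : Type} [Fintype ι] [DecidableEq ι] (s : ι → σ) (a : ι) (c : σ) :
    (X c * ∏ b ∈ Finset.univ.erase a, X (s b) : MvPolynomial σ ℝ) =
      ∏ b, X (Function.update s a c b) := by
  rw [← Finset.mul_prod_erase _ _ (Finset.mem_univ a), Function.update_self]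
  congr 1
  refine Finset.prod_congr rfl fun b hb ↦ ?_
  rw [Function.update_of_ne (Finset.ne_of_mem_erase hb)]

/-- Infinitesimal `gl(n)`-invariance of the functional. It is what makes the terms with Christoffel
symbols cancel when a contraction with the delta is differentiated covariantly. -/
theorem deltaFun_glDer (A : Matrix (Fin n) (Fin n) ℝ) (f : MvPolynomial (Fin n × Fin n) ℝ) :
    deltaFun n (glDer A f) = 0 := by
  suffices (deltaFun n).comp (glDer A).toLinearMap = 0 from LinearMap.congr_fun this f
  refine linearMap_ext_prod_X fun ι _ _ s ↦ ?_
  change deltaFun n (glDer A (∏ a, X (s a))) = 0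
  have h1 : ∀ a m, (fun b ↦ (Function.update s a (m, (s a).2) b).1) =
      Function.update (fun b ↦ (s b).1) a m := by
    intro a m; ext b; by_cases hb : b = a
    · subst hb; simp
    · simp [hb]
  have h2 : ∀ a m, (fun b ↦ (Function.update s a (m, (s a).2) b).2) = (fun b ↦ (s b).2) := by
    intro a m; ext b; by_cases hb : b = a
    · subst hb; simp
    · simp [hb]
  have h3 : ∀ a m, (fun b ↦ (Function.update s a ((s a).1, m) b).2) =
      Function.update (fun b ↦ (s b).2) a m := by
    intro a m; ext b; by_cases hb : b = a
    · subst hb; simp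
    · simp [hb]
  have h4 : ∀ a m, (fun b ↦ (Function.update s a ((s a).1, m) b).1) = (fun b ↦ (s b).1) := by
    intro a m; ext b; by_cases hb : b = a
    · subst hb; simp
    · simp [hb]
  have key : ∀ a, deltaFun n (glDer A (X (s a)) * ∏ b ∈ Finset.univ.erase a, X (s b)) =
      (∑ m, A m (s a).1 * delta (Function.update (fun b ↦ (s b).1) a m) (fun b ↦ (s b).2)) -
      ∑ m, A (s a).2 m * delta (fun b ↦ (s b).1) (Function.update (fun b ↦ (s b).2) a m) := by
    intro a
    rw [← Prod.mk.eta (p := s a), glDer_X, Finset.sum_mul, map_sum, ← Finset.sum_sub_distrib]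
    refine Finset.sum_congr rfl fun m _ ↦ ?_
    rw [sub_mul, smul_mul_assoc, smul_mul_assoc, X_mul_prod_erase, X_mul_prod_erase, map_sub,
      map_smul, map_smul, deltaFun_prod, deltaFun_prod, h1, h2, h3, h4, smul_eq_mul, smul_eq_mul]
  rw [derivation_prod, map_sum]
  simp only [key]
  rw [Finset.sum_sub_distrib, delta_gl_invariant, sub_self]

/-- Integration by parts for the action of `gl(n)`. -/
theorem deltaFun_mul_glDer (A : Matrix (Fin n) (Fin n) ℝ) (f h : MvPolynomial (Fin n × Fin n) ℝ) :
    deltaFun n (f * glDer A h) = -deltaFun n (h * glDer A f) := by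
  have := deltaFun_glDer A (f * h)
  rw [Derivation.leibniz, smul_eq_mul, smul_eq_mul, map_add] at this
  linarith

/-- The exchange of lower and upper indices by means of a bilinear form `G` and its inverse `H`. -/
def metricTranspose (G H : Matrix (Fin n) (Fin n) ℝ) :
    MvPolynomial (Fin n × Fin n) ℝ →ₐ[ℝ] MvPolynomial (Fin n × Fin n) ℝ :=
  aeval fun c ↦ ∑ a, ∑ b, (G c.1 a * H c.2 b) • X (b, a)

theorem deltaFun_metricTranspose {G H : Matrix (Fin n) (Fin n) ℝ} (h : H * Gᵀ = 1)
    (f : MvPolynomial (Fin n × Fin n) ℝ) :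
    deltaFun n (metricTranspose G H f) = deltaFun n f := by
  suffices (deltaFun n).comp (metricTranspose G H).toLinearMap = deltaFun n from
    LinearMap.congr_fun this f
  refine linearMap_ext_prod_X fun ι _ _ s ↦ ?_
  rw [LinearMap.comp_apply, AlgHom.toLinearMap_apply, map_prod, deltaFun_prod,
    ← delta_metric_transpose G H h]
  simp only [metricTranspose, aeval_X]
  simp only [Finset.prod_univ_sum, Fintype.piFinset_univ, map_sum]
  refine Finset.sum_congr rfl fun A _ ↦ Finset.sum_congr rfl fun B _ ↦ ?_
  simp only [← deltaFun_prod (fun a ↦ (B a, A a))]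
  rw [Finset.prod_smul, map_smul, smul_eq_mul, Finset.prod_mul_distrib]

/-! ### Tensors as polynomials -/

/-- The tensor `T_j{}^i = T j i` as the linear form `∑ T_j{}^i X (i, j)`. -/
def elt2 (T : Fin n → Fin n → ℝ) : MvPolynomial (Fin n × Fin n) ℝ :=
  ∑ j, ∑ i, T j i • X (i, j)

/-- The tensor `T_{jl}{}^{ik} = T j l i k` as the quadratic form
`∑ T_{jl}{}^{ik} X (i, j) X (k, l)`. -/
def elt4 (T : Fin n → Fin n → Fin n → Fin n → ℝ) : MvPolynomial (Fin n × Fin n) ℝ :=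
  ∑ j, ∑ l, ∑ i, ∑ k, T j l i k • (X (i, j) * X (k, l))

theorem isHomogeneous_elt2 (T : Fin n → Fin n → ℝ) : (elt2 T).IsHomogeneous 1 :=
  IsHomogeneous.sum _ _ _ fun _ _ ↦ IsHomogeneous.sum _ _ _ fun _ _ ↦
    (homogeneousSubmodule _ ℝ 1).smul_mem _ (isHomogeneous_X ℝ _)

theorem isHomogeneous_elt4 (T : Fin n → Fin n → Fin n → Fin n → ℝ) :
    (elt4 T).IsHomogeneous 2 :=
  IsHomogeneous.sum _ _ _ fun _ _ ↦ IsHomogeneous.sum _ _ _ fun _ _ ↦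
    IsHomogeneous.sum _ _ _ fun _ _ ↦ IsHomogeneous.sum _ _ _ fun _ _ ↦
      (homogeneousSubmodule _ ℝ 2).smul_mem _ ((isHomogeneous_X ℝ _).mul (isHomogeneous_X ℝ _))

theorem isHomogeneous_idElt : (idElt n).IsHomogeneous 1 :=
  IsHomogeneous.sum _ _ _ fun _ _ ↦ isHomogeneous_X ℝ _

theorem elt2_add (S T : Fin n → Fin n → ℝ) :
    elt2 (fun j i ↦ S j i + T j i) = elt2 S + elt2 T := by
  simp only [elt2, add_smul, Finset.sum_add_distrib]

theorem elt4_add (S T : Fin n → Fin n → Fin n → Fin n → ℝ) :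
    elt4 (fun j l i k ↦ S j l i k + T j l i k) = elt4 S + elt4 T := by
  simp only [elt4, add_smul, Finset.sum_add_distrib]

theorem elt4_sub (S T : Fin n → Fin n → Fin n → Fin n → ℝ) :
    elt4 (fun j l i k ↦ S j l i k - T j l i k) = elt4 S - elt4 T := by
  simp only [elt4, sub_smul, Finset.sum_sub_distrib]

/-! ### Contractions with the delta as values of the functional -/

theorem prod_sum_sum {A B N S : Type} [Fintype A] [DecidableEq A] [Fintype B] [DecidableEq B]
    [Fintype N] [CommRing S] (f : A → (B → N) → (B → N) → S) :
    ∏ a, ∑ u, ∑ v, f a u v =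
      ∑ I : A × B → N, ∑ J : A × B → N, ∏ a, f a (fun b ↦ I (a, b)) (fun b ↦ J (a, b)) := by
  classical
  rw [Finset.prod_univ_sum, Fintype.piFinset_univ, ← (Equiv.curry A B N).sum_comp]
  refine Finset.sum_congr rfl fun I _ ↦ ?_
  rw [Finset.prod_univ_sum, Fintype.piFinset_univ, ← (Equiv.curry A B N).sum_comp]
  rfl

theorem sum_sumArrow {A B N S : Type} [Fintype A] [DecidableEq A] [Fintype B] [DecidableEq B]
    [Fintype N] [AddCommMonoid S] (f : (A ⊕ B → N) → S) :
    ∑ I, f I = ∑ I : A → N, ∑ J : B → N, f (Sum.elim I J) := by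
  rw [← (Equiv.sumArrowEquivProdArrow A B N).symm.sum_comp, Fintype.sum_prod_type]
  rfl

theorem sum_finTwoArrow {N S : Type} [Fintype N] [AddCommMonoid S] (f : (Fin 2 → N) → S) :
    ∑ u, f u = ∑ i, ∑ j, f ![i, j] := by
  rw [← (finTwoArrowEquiv N).symm.sum_comp, Fintype.sum_prod_type]
  rfl

theorem elt4_pow (T : Fin n → Fin n → Fin n → Fin n → ℝ) (l : ℕ) :
    elt4 T ^ l = ∑ I : Fin l × Fin 2 → Fin n, ∑ J : Fin l × Fin 2 → Fin n,
      (∏ a, T (J (a, 0)) (J (a, 1)) (I (a, 0)) (I (a, 1))) • ∏ s, X (I s, J s) := by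
  have h : elt4 T = ∑ u : Fin 2 → Fin n, ∑ v : Fin 2 → Fin n,
      T (v 0) (v 1) (u 0) (u 1) • (X (u 0, v 0) * X (u 1, v 1)) := by
    rw [Finset.sum_comm]
    simp only [sum_finTwoArrow, elt4]
    rfl
  rw [← Fin.prod_const, h, prod_sum_sum]
  refine Finset.sum_congr rfl fun I _ ↦ Finset.sum_congr rfl fun J _ ↦ ?_
  rw [Finset.prod_smul, Fintype.prod_prod_type]
  simp only [Fin.prod_univ_two]

theorem elt2_pow (T : Fin n → Fin n → ℝ) (l : ℕ) :
    elt2 T ^ l = ∑ I : Fin l → Fin n, ∑ J : Fin l → Fin n,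
      (∏ a, T (J a) (I a)) • ∏ s, X (I s, J s) := by
  rw [← Fin.prod_const, elt2, Finset.sum_comm, Finset.prod_univ_sum, Fintype.piFinset_univ]
  refine Finset.sum_congr rfl fun I _ ↦ ?_
  rw [Finset.prod_univ_sum, Fintype.piFinset_univ]
  simp only [Finset.prod_smul]

theorem deltaFun_prod_mul_prod {ι κ : Type} [Fintype ι] [DecidableEq ι] [Fintype κ] [DecidableEq κ]
    (I J : ι → Fin n) (I' J' : κ → Fin n) :
    deltaFun n ((∏ a, X (I a, J a)) * ∏ a, X (I' a, J' a)) =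
      delta (Sum.elim I I') (Sum.elim J J') := by
  have : ((∏ a, X (I a, J a)) * ∏ a, X (I' a, J' a) : MvPolynomial (Fin n × Fin n) ℝ) =
      ∏ a : ι ⊕ κ, X (Sum.elim I I' a, Sum.elim J J' a) := by
    simp [Fintype.prod_sum_type]
  rw [this, deltaFun_prod]

theorem deltaFun_elt4_pow (T : Fin n → Fin n → Fin n → Fin n → ℝ) (l : ℕ) :
    deltaFun n (elt4 T ^ l) =
      ∑ I : Fin l × Fin 2 → Fin n, ∑ J : Fin l × Fin 2 → Fin n,
        delta I J * ∏ a, T (J (a, 0)) (J (a, 1)) (I (a, 0)) (I (a, 1)) := by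
  simp only [elt4_pow, map_sum, map_smul, deltaFun_prod, smul_eq_mul, mul_comm]

theorem deltaFun_prod_mul_elt4_pow {ι : Type} [Fintype ι] [DecidableEq ι] (i j : ι → Fin n)
    (T : Fin n → Fin n → Fin n → Fin n → ℝ) (l : ℕ) :
    deltaFun n ((∏ a, X (i a, j a)) * elt4 T ^ l) =
      ∑ I : Fin l × Fin 2 → Fin n, ∑ J : Fin l × Fin 2 → Fin n,
        delta (Sum.elim i I) (Sum.elim j J) *
          ∏ a, T (J (a, 0)) (J (a, 1)) (I (a, 0)) (I (a, 1)) := by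
  simp only [elt4_pow, Finset.mul_sum, mul_smul_comm, map_sum, map_smul, deltaFun_prod_mul_prod,
    smul_eq_mul]
  simp only [mul_comm]

theorem deltaFun_X_mul_elt4_pow_mul_elt2_pow (i j : Fin n)
    (T : Fin n → Fin n → Fin n → Fin n → ℝ) (P : Fin n → Fin n → ℝ) (l m : ℕ) :
    deltaFun n (X (i, j) * (elt4 T ^ l * elt2 P ^ m)) =
      ∑ I : (Fin l × Fin 2) ⊕ Fin m → Fin n, ∑ J : (Fin l × Fin 2) ⊕ Fin m → Fin n,
        delta (Sum.elim ![i] I) (Sum.elim ![j] J) *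
          (∏ a : Fin l, T (J (Sum.inl (a, 0))) (J (Sum.inl (a, 1)))
            (I (Sum.inl (a, 0))) (I (Sum.inl (a, 1)))) *
          ∏ b : Fin m, P (J (Sum.inr b)) (I (Sum.inr b)) := by
  have hX : (X (i, j) : MvPolynomial (Fin n × Fin n) ℝ) =
      ∏ a : Fin 1, X ((![i] : Fin 1 → Fin n) a, (![j] : Fin 1 → Fin n) a) := by simp
  simp only [sum_sumArrow, Sum.elim_inl, Sum.elim_inr]
  rw [elt4_pow, elt2_pow, Finset.sum_mul, Finset.mul_sum, map_sum]
  refine Finset.sum_congr rfl fun I _ ↦ ?_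
  rw [Finset.sum_mul, Finset.mul_sum, map_sum]
  refine (Finset.sum_congr rfl fun J _ ↦ ?_).trans Finset.sum_comm
  rw [Finset.mul_sum, Finset.mul_sum, map_sum]
  refine Finset.sum_congr rfl fun I' _ ↦ ?_
  rw [Finset.mul_sum, Finset.mul_sum, map_sum]
  refine Finset.sum_congr rfl fun J' _ ↦ ?_
  have h2 : ((∏ s, X (I s, J s)) * ∏ s, X (I' s, J' s) : MvPolynomial (Fin n × Fin n) ℝ) =
      ∏ s, X (Sum.elim I I' s, Sum.elim J J' s) := by
    simp [Fintype.prod_sum_type]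
  rw [smul_mul_smul_comm, mul_smul_comm, map_smul, h2, hX, deltaFun_prod_mul_prod, smul_eq_mul]
  ring

/-! ### Calculus modulo the radical of the functional -/

/-- The largest ideal in the kernel of `deltaFun`. Identities between polynomials modulo this
ideal are identities between tensors contracted with the delta. -/
def deltaIdeal (n : ℕ) : Ideal (MvPolynomial (Fin n × Fin n) ℝ) where
  carrier := {f | ∀ h, deltaFun n (h * f) = 0}
  add_mem' hf hg h := by rw [mul_add, map_add, hf, hg, add_zero]
  zero_mem' h := by rw [mul_zero, map_zero]
  smul_mem' c f hf h := by rw [smul_eq_mul, ← mul_assoc]; exact hf _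

/-- The projection to the quotient by `deltaIdeal`. -/
abbrev deltaMk (n : ℕ) : MvPolynomial (Fin n × Fin n) ℝ →+*
    MvPolynomial (Fin n × Fin n) ℝ ⧸ deltaIdeal n :=
  Ideal.Quotient.mk (deltaIdeal n)

theorem deltaMk_eq {f g : MvPolynomial (Fin n × Fin n) ℝ} :
    deltaMk n f = deltaMk n g ↔ ∀ h, deltaFun n (h * f) = deltaFun n (h * g) := by
  rw [Ideal.Quotient.eq]
  refine forall_congr' fun h ↦ ?_
  rw [mul_sub, map_sub, sub_eq_zero]

theorem deltaFun_congr {f g : MvPolynomial (Fin n × Fin n) ℝ} (h : deltaMk n f = deltaMk n g) :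
    deltaFun n f = deltaFun n g := by
  simpa using deltaMk_eq.1 h 1

theorem deltaMk_glDer_congr (A : Matrix (Fin n) (Fin n) ℝ) {f g : MvPolynomial (Fin n × Fin n) ℝ}
    (h : deltaMk n f = deltaMk n g) : deltaMk n (glDer A f) = deltaMk n (glDer A g) := by
  rw [deltaMk_eq] at h ⊢
  intro q
  rw [deltaFun_mul_glDer A q f, deltaFun_mul_glDer A q g, mul_comm f, mul_comm g, h]

theorem deltaMk_antisymm (i j k l : Fin n) :
    deltaMk n (X (i, l) * X (k, j)) = deltaMk n (-(X (i, j) * X (k, l))) := by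
  rw [deltaMk_eq]
  intro h
  rw [deltaFun_antisymm, mul_neg, map_neg]

theorem deltaMk_sum_congr {α : Type} {s : Finset α} {f g : α → MvPolynomial (Fin n × Fin n) ℝ}
    (h : ∀ a ∈ s, deltaMk n (f a) = deltaMk n (g a)) :
    deltaMk n (∑ a ∈ s, f a) = deltaMk n (∑ a ∈ s, g a) := by
  rw [map_sum, map_sum]
  exact Finset.sum_congr rfl h

theorem deltaMk_smul_congr (c : ℝ) {f g : MvPolynomial (Fin n × Fin n) ℝ}
    (h : deltaMk n f = deltaMk n g) : deltaMk n (c • f) = deltaMk n (c • g) := by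
  rw [smul_eq_C_mul, smul_eq_C_mul, map_mul, map_mul, h]

theorem deltaMk_elt4_swap_upper (T : Fin n → Fin n → Fin n → Fin n → ℝ) :
    deltaMk n (elt4 fun j l i k ↦ T j l k i) = deltaMk n (-elt4 T) := by
  have h : elt4 (fun j l i k ↦ T j l k i) =
      ∑ j, ∑ l, ∑ i, ∑ k, T j l i k • (X (i, l) * X (k, j)) := by
    refine Finset.sum_congr rfl fun j _ ↦ Finset.sum_congr rfl fun l _ ↦ ?_
    rw [Finset.sum_comm]
    refine Finset.sum_congr rfl fun i _ ↦ Finset.sum_congr rfl fun k _ ↦ ?_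
    rw [mul_comm]
  rw [h]
  simp only [elt4, ← Finset.sum_neg_distrib, ← smul_neg]
  exact deltaMk_sum_congr fun _ _ ↦ deltaMk_sum_congr fun _ _ ↦ deltaMk_sum_congr fun _ _ ↦
    deltaMk_sum_congr fun _ _ ↦ deltaMk_smul_congr _ (deltaMk_antisymm _ _ _ _)

theorem elt4_swap_pairs (T : Fin n → Fin n → Fin n → Fin n → ℝ) :
    elt4 (fun j l i k ↦ T l j k i) = elt4 T := by
  rw [elt4, Finset.sum_comm]
  refine Finset.sum_congr rfl fun j _ ↦ Finset.sum_congr rfl fun l _ ↦ ?_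
  rw [Finset.sum_comm]
  refine Finset.sum_congr rfl fun i _ ↦ Finset.sum_congr rfl fun k _ ↦ ?_
  rw [mul_comm]

theorem deltaMk_elt4_swap_lower (T : Fin n → Fin n → Fin n → Fin n → ℝ) :
    deltaMk n (elt4 fun j l i k ↦ T l j i k) = deltaMk n (-elt4 T) := by
  rw [← elt4_swap_pairs]
  exact deltaMk_elt4_swap_upper T

/-- The Kulkarni–Nomizu product of `P` with the identity, with components
`P_j^i δ_l^k - P_j^k δ_l^i + P_l^k δ_j^i - P_l^i δ_j^k`. -/
def knProd (P : Fin n → Fin n → ℝ) (j l i k : Fin n) : ℝ :=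
  P j i * (if l = k then 1 else 0) - P j k * (if l = i then 1 else 0)
    + P l k * (if j = i then 1 else 0) - P l i * (if j = k then 1 else 0)

theorem deltaMk_elt4_knProd (P : Fin n → Fin n → ℝ) :
    deltaMk n (elt4 (knProd P)) = deltaMk n (4 * elt2 P * idElt n) := by
  set T : Fin n → Fin n → Fin n → Fin n → ℝ := fun j l i k ↦ P j i * (if l = k then 1 else 0)
    with hT
  have h0 : elt4 T = elt2 P * idElt n := by
    have hθ : (idElt n : MvPolynomial (Fin n × Fin n) ℝ) =
        ∑ l, ∑ k, (if l = k then (1 : ℝ) else 0) • X (k, l) := by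
      simp [idElt, ite_smul]
    rw [hθ, elt2, elt4, Finset.sum_mul]
    refine Finset.sum_congr rfl fun j _ ↦ ?_
    rw [Finset.sum_comm, Finset.sum_mul]
    refine Finset.sum_congr rfl fun i _ ↦ ?_
    simp only [Finset.mul_sum, smul_mul_smul_comm, hT]
  have h1 : elt4 (knProd P) = elt4 T - elt4 (fun j l i k ↦ T j l k i) +
      elt4 (fun j l i k ↦ T l j k i) - elt4 (fun j l i k ↦ T l j i k) := by
    have : knProd P = fun j l i k ↦ T j l i k - T j l k i + T l j k i - T l j i k := by
      ext j l i k
      simp only [knProd, hT]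
    rw [this, elt4_sub (fun j l i k ↦ T j l i k - T j l k i + T l j k i) fun j l i k ↦ T l j i k,
      elt4_add (fun j l i k ↦ T j l i k - T j l k i) fun j l i k ↦ T l j k i,
      elt4_sub T fun j l i k ↦ T j l k i]
  rw [h1, map_sub, map_add, map_sub, deltaMk_elt4_swap_upper T, deltaMk_elt4_swap_lower T,
    elt4_swap_pairs T, h0]
  simp only [map_neg, map_mul, map_ofNat]
  ring

/-- The form `∑ V_{jl}{}^k X (i, j) X (k, l)` attached to a tensor `V_{jl}{}^k = V j l k`, with
a free lower index `i`. -/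
def elt3 (V : Fin n → Fin n → Fin n → ℝ) (i : Fin n) : MvPolynomial (Fin n × Fin n) ℝ :=
  ∑ j, ∑ l, ∑ k, V j l k • (X (i, j) * X (k, l))

theorem isHomogeneous_elt3 (V : Fin n → Fin n → Fin n → ℝ) (i : Fin n) :
    (elt3 V i).IsHomogeneous 2 :=
  IsHomogeneous.sum _ _ _ fun _ _ ↦ IsHomogeneous.sum _ _ _ fun _ _ ↦
    IsHomogeneous.sum _ _ _ fun _ _ ↦
      (homogeneousSubmodule _ ℝ 2).smul_mem _ ((isHomogeneous_X ℝ _).mul (isHomogeneous_X ℝ _))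

theorem sum_X_mul_elt2 (V : Fin n → Fin n → Fin n → ℝ) (i : Fin n) :
    ∑ j, X (i, j) * elt2 (V j) = elt3 V i := by
  simp only [elt3, elt2, Finset.mul_sum, mul_smul_comm]

/-- The delta antisymmetrizes the indices of a derivative `∇_j P_l{}^k`. -/
theorem deltaMk_two_mul_sum_X_mul_elt2 (V : Fin n → Fin n → Fin n → ℝ) (i : Fin n) :
    deltaMk n (2 * ∑ j, X (i, j) * elt2 (V j)) =
      deltaMk n (elt3 (fun j l k ↦ V j l k - V l j k) i) := by
  have h : deltaMk n (elt3 (fun j l k ↦ V l j k) i) = deltaMk n (-elt3 V i) := by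
    rw [elt3, Finset.sum_comm]
    simp only [elt3, ← Finset.sum_neg_distrib, ← smul_neg]
    exact deltaMk_sum_congr fun _ _ ↦ deltaMk_sum_congr fun _ _ ↦ deltaMk_sum_congr fun _ _ ↦
      deltaMk_smul_congr _ (deltaMk_antisymm _ _ _ _)
  have h2 : elt3 (fun j l k ↦ V j l k - V l j k) i = elt3 V i - elt3 (fun j l k ↦ V l j k) i := by
    simp only [elt3, sub_smul, Finset.sum_sub_distrib]
  rw [sum_X_mul_elt2, h2, map_sub, h, ← map_sub]
  congr 1
  ring

/-- The delta annihilates a derivative `∇_j R_{lm}{}^{kp}` satisfying the second Bianchi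
identity. -/
theorem deltaMk_sum_X_mul_elt4_eq_zero (V : Fin n → Fin n → Fin n → Fin n → Fin n → ℝ)
    (hV : ∀ j l m k p, V j l m k p + V l m j k p + V m j l k p = 0) (i : Fin n) :
    deltaMk n (∑ j, X (i, j) * elt4 (V j)) = 0 := by
  set F : (Fin n → Fin n → Fin n → Fin n → Fin n → ℝ) → MvPolynomial (Fin n × Fin n) ℝ :=
    fun V ↦ ∑ j, ∑ l, ∑ m, ∑ k, ∑ p, V j l m k p • (X (i, j) * (X (k, l) * X (p, m))) with hF
  have hF0 : ∀ V, ∑ j, X (i, j) * elt4 (V j) = F V := by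
    intro V
    simp only [hF, elt4, Finset.mul_sum, mul_smul_comm]
  have hcyc : ∀ V, deltaMk n (F fun j l m k p ↦ V l m j k p) = deltaMk n (F V) := by
    intro V
    have h1 : (F fun j l m k p ↦ V l m j k p) =
        ∑ j, ∑ l, ∑ m, ∑ k, ∑ p, V j l m k p • (X (i, m) * (X (k, j) * X (p, l))) := by
      simp only [hF]
      rw [Finset.sum_comm]
      exact Finset.sum_congr rfl fun _ _ ↦ Finset.sum_comm
    rw [h1]
    refine deltaMk_sum_congr fun j _ ↦ deltaMk_sum_congr fun l _ ↦ deltaMk_sum_congr fun m _ ↦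
      deltaMk_sum_congr fun k _ ↦ deltaMk_sum_congr fun p _ ↦ deltaMk_smul_congr _ ?_
    have e1 := deltaMk_antisymm i j k m
    have e2 := deltaMk_antisymm k l p m
    rw [map_mul, map_neg, map_mul] at e1 e2
    simp only [map_mul]
    linear_combination deltaMk n (X (p, l)) * e1 - deltaMk n (X (i, j)) * e2
  have h3 : deltaMk n (F V) + deltaMk n (F V) + deltaMk n (F V) = 0 := by
    have e1 := hcyc V
    have e2 := hcyc fun j l m k p ↦ V l m j k p
    have : F V + (F fun j l m k p ↦ V l m j k p) + (F fun j l m k p ↦ V m j l k p) = 0 := by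
      simp only [hF, ← Finset.sum_add_distrib, ← add_smul, hV, zero_smul, Finset.sum_const_zero]
    have e3 := congr_arg (deltaMk n) this
    rw [map_add, map_add, map_zero] at e3
    rw [e2, e1] at e3
    exact e3
  rw [hF0]
  rw [← map_zero (deltaMk n), ← map_add, ← map_add, deltaMk_eq] at h3
  rw [← map_zero (deltaMk n), deltaMk_eq]
  intro h
  have := h3 h
  simp only [mul_add, map_add, mul_zero, map_zero] at this ⊢
  linarith

/-! ### The algebra behind the transgression -/

theorem deltaFun_natCast_mul (m : ℕ) (f : MvPolynomial (Fin n × Fin n) ℝ) :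
    deltaFun n (m * f) = m * deltaFun n f := by
  rw [← nsmul_eq_mul, map_nsmul, nsmul_eq_mul]

/-- In complementary degree, all remaining pairs of indices can be traced out. -/
theorem deltaFun_mul_idElt_pow {f : MvPolynomial (Fin n × Fin n) ℝ} {d s : ℕ}
    (hf : f.IsHomogeneous d) (hn : n = d + s) :
    deltaFun n (f * idElt n ^ s) = s.factorial * deltaFun n f := by
  induction s generalizing f d with
  | zero => simp
  | succ s ih =>
    have hn' : (n : ℝ) = d + (s + 1) := by exact_mod_cast hn
    rw [pow_succ', ← mul_assoc, ih (hf.mul isHomogeneous_idElt) (by omega), deltaFun_mul_idElt hf,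
      hn', Nat.factorial_succ]
    push_cast
    ring

/-- The polynomial `∑_{ℓ < k} 4^{k-ℓ} / (ℓ! (k-ℓ)) w^ℓ p^{k-ℓ}` whose contractions with the delta
are the components of `Ω`. -/
def omegaElt (k : ℕ) (w p : MvPolynomial (Fin n × Fin n) ℝ) : MvPolynomial (Fin n × Fin n) ℝ :=
  ∑ l ∈ Finset.range k,
    ((4 : ℝ) ^ (k - l) * (1 / ((l.factorial : ℝ) * ((k : ℝ) - (l : ℝ))))) • (w ^ l * p ^ (k - l))

/-- The differential of `omegaElt` at `(w, p)` in the direction `(w', p')`. -/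
def omegaEltDeriv (k : ℕ) (w p w' p' : MvPolynomial (Fin n × Fin n) ℝ) :
    MvPolynomial (Fin n × Fin n) ℝ :=
  ∑ l ∈ Finset.range k,
    ((4 : ℝ) ^ (k - l) * (1 / ((l.factorial : ℝ) * ((k : ℝ) - (l : ℝ))))) •
      (w ^ l * (((k - l : ℕ) : MvPolynomial (Fin n × Fin n) ℝ) * (p ^ (k - l - 1) * p')) +
        p ^ (k - l) * ((l : MvPolynomial (Fin n × Fin n) ℝ) * (w ^ (l - 1) * w')))

theorem omegaEltDeriv_add (k : ℕ) (w p w₁ p₁ w₂ p₂ : MvPolynomial (Fin n × Fin n) ℝ) :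
    omegaEltDeriv k w p (w₁ + w₂) (p₁ + p₂) =
      omegaEltDeriv k w p w₁ p₁ + omegaEltDeriv k w p w₂ p₂ := by
  rw [omegaEltDeriv, omegaEltDeriv, omegaEltDeriv, ← Finset.sum_add_distrib]
  refine Finset.sum_congr rfl fun l _ ↦ ?_
  rw [← smul_add]
  congr 1
  ring

theorem derivation_omegaElt (D : Derivation ℝ (MvPolynomial (Fin n × Fin n) ℝ)
    (MvPolynomial (Fin n × Fin n) ℝ)) (k : ℕ) (w p : MvPolynomial (Fin n × Fin n) ℝ) :
    D (omegaElt k w p) = omegaEltDeriv k w p (D w) (D p) := by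
  rw [omegaElt, omegaEltDeriv, map_sum]
  refine Finset.sum_congr rfl fun l _ ↦ ?_
  rw [Derivation.map_smul, Derivation.leibniz, Derivation.leibniz_pow, Derivation.leibniz_pow]
  simp only [smul_eq_mul, nsmul_eq_mul]

theorem sum_deltaFun_X_mul (f : MvPolynomial (Fin n × Fin n) ℝ) :
    ∑ i, deltaFun n (X (i, i) * f) = deltaFun n (f * idElt n) := by
  rw [idElt, Finset.mul_sum, map_sum]
  simp only [mul_comm]

/-- If `r = w + 4 p θ` modulo `deltaIdeal`, the binomial theorem expresses the Pfaffian of `r`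
through the Pfaffian of `w` and the trace of `Ω`. -/
theorem deltaFun_pow_eq_add_trace {k : ℕ} (hn : n = 2 * k)
    {r w p : MvPolynomial (Fin n × Fin n) ℝ} (hw : w.IsHomogeneous 2) (hp : p.IsHomogeneous 1)
    (hr : deltaMk n r = deltaMk n (w + 4 * p * idElt n)) :
    1 / (k.factorial : ℝ) * deltaFun n (r ^ k) =
      1 / (k.factorial : ℝ) * deltaFun n (w ^ k) +
        ∑ i, deltaFun n (X (i, i) * omegaElt k w p) := by
  have hn' : (n : ℝ) = 2 * k := by exact_mod_cast hn
  have h1 : deltaFun n (r ^ k) = deltaFun n ((w + 4 * p * idElt n) ^ k) :=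
    deltaFun_congr (by rw [map_pow, map_pow, hr])
  have hhom : ∀ l ∈ Finset.range k, (w ^ l * p ^ (k - l)).IsHomogeneous (k + l) := by
    intro l hl
    have hl := Finset.mem_range.1 hl
    have := (hw.pow l).mul (hp.pow (k - l))
    rwa [show 2 * l + 1 * (k - l) = k + l by omega] at this
  -- all but one of the factors `θ` are traced out on the right, where the last one gives the trace
  -- of `Ω`
  have h2 : ∀ l ∈ Finset.range k,
      deltaFun n (w ^ l * (4 * p * idElt n) ^ (k - l) *
        ((k.choose l : ℕ) : MvPolynomial (Fin n × Fin n) ℝ)) =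
      k.factorial * ((4 : ℝ) ^ (k - l) * (1 / ((l.factorial : ℝ) * ((k : ℝ) - (l : ℝ)))) *
        deltaFun n (w ^ l * p ^ (k - l) * idElt n)) := by
    intro l hl
    have hlk := Finset.mem_range.1 hl
    have e1 : w ^ l * (4 * p * idElt n) ^ (k - l) *
        ((k.choose l : ℕ) : MvPolynomial (Fin n × Fin n) ℝ) =
        ((k.choose l : ℝ) * 4 ^ (k - l)) • (w ^ l * p ^ (k - l) * idElt n ^ (k - l)) := by
      rw [smul_eq_C_mul, map_mul, map_pow, map_natCast, map_ofNat, mul_pow, mul_pow]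
      ring
    rw [e1, map_smul, smul_eq_mul, deltaFun_mul_idElt_pow (hhom l hl) (by omega),
      deltaFun_mul_idElt (hhom l hl), hn', Nat.choose_eq_factorial_div_factorial hlk.le,
      Nat.cast_div (Nat.factorial_mul_factorial_dvd_factorial hlk.le) (by positivity)]
    have e2 : (k : ℝ) - l ≠ 0 := by
      rw [sub_ne_zero]
      exact_mod_cast hlk.ne'
    have e3 : ((k - l).factorial : ℝ) ≠ 0 := by positivity
    have e4 : (l.factorial : ℝ) ≠ 0 := by positivity
    push_cast
    field_simp
    ring
  have hk : (k.factorial : ℝ) ≠ 0 := by positivity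
  rw [h1, add_pow, Finset.sum_range_succ, map_add, map_sum, Finset.sum_congr rfl h2,
    ← Finset.mul_sum, sum_deltaFun_X_mul, omegaElt, Finset.sum_mul, map_sum]
  simp only [smul_mul_assoc, map_smul, smul_eq_mul, Nat.sub_self, pow_zero, mul_one,
    Nat.choose_self, Nat.cast_one]
  field_simp
  ring

/-- The telescoping sum: if `w'` and `p'` are the covariant derivatives of `w` and `p`, the
hypotheses say that the delta turns `p'` into half the Cotton tensor `c` and `w'` into
`-2 c θ`, and all terms except the one with `w ^ (k - 1)` cancel. -/
theorem sum_deltaFun_X_mul_omegaEltDeriv {k : ℕ} (hn : n = 2 * k)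
    {w p c : MvPolynomial (Fin n × Fin n) ℝ} {w' p' : Fin n → MvPolynomial (Fin n × Fin n) ℝ}
    (i : Fin n) (hw : w.IsHomogeneous 2) (hp : p.IsHomogeneous 1) (hc : c.IsHomogeneous 2)
    (hw' : deltaMk n (∑ j, X (i, j) * w' j) = deltaMk n (-2 * c * idElt n))
    (hp' : deltaMk n (2 * ∑ j, X (i, j) * p' j) = deltaMk n c) :
    ∑ j, deltaFun n (X (i, j) * omegaEltDeriv k w p (w' j) (p' j)) =
      2 * k * (1 / (k.factorial : ℝ) * deltaFun n (c * w ^ (k - 1))) := by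
  have hn' : (n : ℝ) = 2 * k := by exact_mod_cast hn
  set Q : ℕ → ℝ := fun l ↦ deltaFun n (w ^ l * p ^ (k - 1 - l) * c) with hQ
  -- the terms in which a factor `w` is differentiated
  have hA : ∀ l, l + 1 < k → ∑ j, deltaFun n (X (i, j) * (p ^ (k - (l + 1)) *
      (((l + 1 : ℕ) : MvPolynomial (Fin n × Fin n) ℝ) * (w ^ l * w' j)))) =
      -2 * (l + 1) * (k - (l + 1)) * Q l := by
    intro l hl
    have hhom : (w ^ l * p ^ (k - 1 - l) * c).IsHomogeneous (k + l + 1) := by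
      have := ((hw.pow l).mul (hp.pow (k - 1 - l))).mul hc
      rwa [show 2 * l + 1 * (k - 1 - l) + 2 = k + l + 1 by omega] at this
    have e1 : ∑ j, deltaFun n (X (i, j) * (p ^ (k - (l + 1)) *
        (((l + 1 : ℕ) : MvPolynomial (Fin n × Fin n) ℝ) * (w ^ l * w' j)))) =
        ((l + 1 : ℕ) : ℝ) *
          deltaFun n ((w ^ l * p ^ (k - 1 - l)) * ∑ j, X (i, j) * w' j) := by
      rw [Finset.mul_sum, map_sum, Finset.mul_sum]
      refine Finset.sum_congr rfl fun j _ ↦ ?_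
      rw [← deltaFun_natCast_mul, show k - (l + 1) = k - 1 - l by omega]
      congr 1
      ring
    have e2 : w ^ l * p ^ (k - 1 - l) * (-2 * c * idElt n) =
        (-2 : ℝ) • (w ^ l * p ^ (k - 1 - l) * c * idElt n) := by
      rw [smul_eq_C_mul, map_neg, map_ofNat]
      ring
    rw [e1, deltaMk_eq.1 hw', e2, map_smul, deltaFun_mul_idElt hhom, hn', smul_eq_mul]
    push_cast
    ring
  -- the terms in which a factor `p` is differentiated
  have hB : ∀ l, l < k → ∑ j, deltaFun n (X (i, j) * (w ^ l *
      (((k - l : ℕ) : MvPolynomial (Fin n × Fin n) ℝ) * (p ^ (k - l - 1) * p' j)))) =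
      (k - l) / 2 * Q l := by
    intro l hl
    have e1 : ∑ j, deltaFun n (X (i, j) * (w ^ l *
      (((k - l : ℕ) : MvPolynomial (Fin n × Fin n) ℝ) * (p ^ (k - l - 1) * p' j)))) =
        ((k - l : ℕ) : ℝ) / 2 *
          deltaFun n ((w ^ l * p ^ (k - 1 - l)) * (2 * ∑ j, X (i, j) * p' j)) := by
      rw [Finset.mul_sum, Finset.mul_sum, map_sum, Finset.mul_sum]
      refine Finset.sum_congr rfl fun j _ ↦ ?_
      have : w ^ l * p ^ (k - 1 - l) * (2 * (X (i, j) * p' j)) =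
          (2 : ℝ) • (w ^ l * p ^ (k - 1 - l) * (X (i, j) * p' j)) := by
        rw [smul_eq_C_mul, map_ofNat]
        ring
      have h2 : ∀ x y : ℝ, x / 2 * (2 * y) = x * y := fun x y ↦ by ring
      rw [this, map_smul, smul_eq_mul, h2, ← deltaFun_natCast_mul,
        show k - l - 1 = k - 1 - l by omega]
      congr 1
      ring
    rw [e1, deltaMk_eq.1 hp', Nat.cast_sub hl.le]
  -- `f l` is what the terms `l - 1` and `l` contribute with opposite signs;
  -- the factor `l` makes the truncated subtraction at `l = 0` harmless
  set f : ℕ → ℝ := fun l ↦ 2 * 4 ^ (k - l) * l / (l.factorial : ℝ) * Q (l - 1) with hf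
  have hterm : ∀ l ∈ Finset.range k, ∑ j, deltaFun n (X (i, j) *
      ((4 : ℝ) ^ (k - l) * (1 / ((l.factorial : ℝ) * ((k : ℝ) - (l : ℝ))))) •
      (w ^ l * (((k - l : ℕ) : MvPolynomial (Fin n × Fin n) ℝ) * (p ^ (k - l - 1) * p' j)) +
        p ^ (k - l) * ((l : MvPolynomial (Fin n × Fin n) ℝ) * (w ^ (l - 1) * w' j)))) =
      f (l + 1) - f l := by
    intro l hl
    have hlk := Finset.mem_range.1 hl
    have hne : (k : ℝ) - l ≠ 0 := by
      rw [sub_ne_zero]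
      exact_mod_cast hlk.ne'
    simp only [mul_smul_comm, map_smul, smul_eq_mul, mul_add, map_add, ← Finset.mul_sum,
      Finset.sum_add_distrib]
    have hB' := hB l hlk
    have hfl : f (l + 1) = (4 : ℝ) ^ (k - l) * (1 / ((l.factorial : ℝ) * ((k : ℝ) - (l : ℝ)))) *
        ((k - l) / 2 * Q l) := by
      have e4 : (l.factorial : ℝ) ≠ 0 := by positivity
      have e5 : (l : ℝ) + 1 ≠ 0 := by positivity
      simp only [hf, Nat.add_sub_cancel]
      rw [show k - l = k - (l + 1) + 1 by omega, pow_succ, Nat.factorial_succ]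
      push_cast
      field_simp
      ring
    rw [hfl, hB']
    refine Eq.trans ?_ (sub_eq_add_neg _ _).symm
    congr 1
    cases l with
    | zero => simp [hf]
    | succ l =>
      simp only [Nat.add_sub_cancel]
      rw [hA l hlk]
      have e4 : (l.factorial : ℝ) ≠ 0 := by positivity
      have e5 : (l : ℝ) + 1 ≠ 0 := by positivity
      simp only [hf, Nat.add_sub_cancel]
      rw [Nat.factorial_succ]
      push_cast at hne ⊢
      field_simp
  simp only [omegaEltDeriv, Finset.mul_sum, map_sum]
  rw [Finset.sum_comm, Finset.sum_congr rfl hterm, Finset.sum_range_sub]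
  simp only [hf, hQ, Nat.sub_self, pow_zero, mul_one, Nat.cast_zero, mul_zero, zero_div, zero_mul,
    sub_zero, mul_comm c]
  ring

/-! ### Exchange of lower and upper indices -/

/-- The variables `X (i, j)` with the index `i` lowered, for `H` the inverse metric. -/
def lowX (H : Matrix (Fin n) (Fin n) ℝ) (p j : Fin n) : MvPolynomial (Fin n × Fin n) ℝ :=
  ∑ i, H i p • X (i, j)

theorem metricTranspose_lowX {G H : Matrix (Fin n) (Fin n) ℝ} (hHG : H * G = 1)
    (hH : H.IsSymm) (p j : Fin n) :
    metricTranspose G H (lowX H p j) = lowX H j p := by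
  have h : ∀ a, ∑ i, H i p * G i a = if p = a then 1 else 0 := by
    intro a
    rw [← Matrix.one_apply, ← hHG, Matrix.mul_apply]
    exact Finset.sum_congr rfl fun i _ ↦ by rw [hH.apply]
  simp only [lowX, map_sum, map_smul, metricTranspose, aeval_X, Finset.smul_sum, smul_smul]
  rw [Finset.sum_comm]
  have h2 : ∀ a, ∑ i, ∑ b, (H i p * (G i a * H j b)) • (X (b, a) : MvPolynomial _ ℝ) =
      ∑ b, ((if p = a then 1 else 0) * H j b) • X (b, a) := by
    intro a
    rw [Finset.sum_comm]
    refine Finset.sum_congr rfl fun b _ ↦ ?_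
    rw [← h a, Finset.sum_mul, Finset.sum_smul]
    simp only [mul_assoc]
  rw [Finset.sum_congr rfl fun a _ ↦ h2 a, Finset.sum_comm]
  refine Finset.sum_congr rfl fun b _ ↦ ?_
  simp [ite_smul, hH.apply]

theorem elt2_raise (H : Matrix (Fin n) (Fin n) ℝ) (P : Fin n → Fin n → ℝ) :
    elt2 (fun j i ↦ ∑ p, H i p * P j p) = ∑ j, ∑ p, P j p • lowX H p j := by
  simp only [elt2, lowX, Finset.sum_smul, Finset.smul_sum, smul_smul]
  refine Finset.sum_congr rfl fun j _ ↦ ?_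
  rw [Finset.sum_comm]
  simp only [mul_comm]

theorem sum_swap_pairs {V : Type} [AddCommMonoid V] (F : Fin n → Fin n → Fin n → Fin n → V) :
    ∑ i, ∑ k, ∑ p, ∑ q, F i k p q = ∑ p, ∑ q, ∑ i, ∑ k, F i k p q := by
  calc _ = ∑ i, ∑ p, ∑ q, ∑ k, F i k p q := by
        refine Finset.sum_congr rfl fun i _ ↦ ?_
        rw [Finset.sum_comm]
        exact Finset.sum_congr rfl fun p _ ↦ Finset.sum_comm
    _ = _ := by
        rw [Finset.sum_comm]
        exact Finset.sum_congr rfl fun p _ ↦ Finset.sum_comm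

theorem elt4_raise (H : Matrix (Fin n) (Fin n) ℝ) (R : Fin n → Fin n → Fin n → Fin n → ℝ) :
    elt4 (fun j l i k ↦ ∑ p, ∑ q, H i p * H k q * R j l p q) =
      ∑ j, ∑ l, ∑ p, ∑ q, R j l p q • (lowX H p j * lowX H q l) := by
  simp only [elt4]
  refine Finset.sum_congr rfl fun j _ ↦ Finset.sum_congr rfl fun l _ ↦ ?_
  have h1 : ∀ p q, R j l p q • (lowX H p j * lowX H q l) =
      ∑ i, ∑ k, (H i p * H k q * R j l p q) • (X (i, j) * X (k, l)) := by
    intro p q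
    rw [lowX, lowX, Finset.sum_mul_sum, Finset.smul_sum]
    refine Finset.sum_congr rfl fun i _ ↦ ?_
    rw [Finset.smul_sum]
    refine Finset.sum_congr rfl fun k _ ↦ ?_
    rw [smul_mul_smul_comm, smul_smul, mul_comm]
  simp only [h1, Finset.sum_smul]
  exact sum_swap_pairs _

theorem metricTranspose_elt2_raise {G H : Matrix (Fin n) (Fin n) ℝ} (hHG : H * G = 1)
    (hH : H.IsSymm) {P : Fin n → Fin n → ℝ} (hP : ∀ i j, P i j = P j i) :
    metricTranspose G H (elt2 fun j i ↦ ∑ p, H i p * P j p) =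
      elt2 fun j i ↦ ∑ p, H i p * P j p := by
  simp only [elt2_raise, map_sum, map_smul, metricTranspose_lowX hHG hH]
  rw [Finset.sum_comm]
  exact Finset.sum_congr rfl fun _ _ ↦ Finset.sum_congr rfl fun _ _ ↦ by rw [hP]

theorem metricTranspose_elt4_raise {G H : Matrix (Fin n) (Fin n) ℝ} (hHG : H * G = 1)
    (hH : H.IsSymm) {R : Fin n → Fin n → Fin n → Fin n → ℝ}
    (hR : ∀ i j k l, R i j k l = R k l i j) :
    metricTranspose G H (elt4 fun j l i k ↦ ∑ p, ∑ q, H i p * H k q * R j l p q) =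
      elt4 fun j l i k ↦ ∑ p, ∑ q, H i p * H k q * R j l p q := by
  simp only [elt4_raise, map_sum, map_smul, map_mul, metricTranspose_lowX hHG hH]
  rw [sum_swap_pairs]
  exact Finset.sum_congr rfl fun _ _ ↦ Finset.sum_congr rfl fun _ _ ↦
    Finset.sum_congr rfl fun _ _ ↦ Finset.sum_congr rfl fun _ _ ↦ by rw [hR]

/-- Contracting the delta with an element invariant under the exchange of lower and upper indices
gives a symmetric tensor. -/
theorem sum_deltaFun_mul_symm {G H : Matrix (Fin n) (Fin n) ℝ} (hHG : H * G = 1)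
    (hG : G.IsSymm) {f : MvPolynomial (Fin n × Fin n) ℝ} (hf : metricTranspose G H f = f)
    (i j : Fin n) :
    ∑ m, deltaFun n (X (i, m) * f) * G m j = ∑ m, deltaFun n (X (j, m) * f) * G m i := by
  have hGH : G * H = 1 := mul_eq_one_comm.1 hHG
  have h1 : ∀ m, deltaFun n (X (i, m) * f) =
      ∑ a, ∑ b, G i a * H m b * deltaFun n (X (b, a) * f) := by
    intro m
    rw [← deltaFun_metricTranspose (G := G) (H := H) (by rw [hG.eq, hHG]), map_mul, hf,
      metricTranspose, aeval_X]
    simp only [Finset.sum_mul, map_sum, smul_mul_assoc, map_smul, smul_eq_mul]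
  have h2 : ∀ b, ∑ m, H m b * G m j = if j = b then 1 else 0 := by
    intro b
    rw [← Matrix.one_apply, ← hGH, Matrix.mul_apply]
    exact Finset.sum_congr rfl fun m _ ↦ by rw [hG.apply, mul_comm]
  simp only [h1, Finset.sum_mul]
  rw [Finset.sum_comm]
  refine Finset.sum_congr rfl fun a _ ↦ ?_
  rw [Finset.sum_comm]
  calc _ = ∑ b, (G i a * deltaFun n (X (b, a) * f)) * ∑ m, H m b * G m j := by
        refine Finset.sum_congr rfl fun b _ ↦ ?_
        rw [Finset.mul_sum]
        exact Finset.sum_congr rfl fun m _ ↦ by ring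
    _ = _ := by
        simp only [h2, mul_ite, mul_one, mul_zero, Finset.sum_ite_eq, Finset.mem_univ, if_true]
        rw [hG.apply, mul_comm]

/-! ### Partial derivatives of functions and matrices -/

section PartialDerivatives

variable {y : EuclideanSpace ℝ (Fin n)} {f h : EuclideanSpace ℝ (Fin n) → ℝ} (i j : Fin n)

theorem pd_add (hf : DifferentiableAt ℝ f y) (hh : DifferentiableAt ℝ h y) :
    pd i (fun z ↦ f z + h z) y = pd i f y + pd i h y := by
  rw [pd, fderiv_fun_add hf hh]; rfl

theorem pd_sub (hf : DifferentiableAt ℝ f y) (hh : DifferentiableAt ℝ h y) :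
    pd i (fun z ↦ f z - h z) y = pd i f y - pd i h y := by
  rw [pd, fderiv_fun_sub hf hh]; rfl

theorem pd_mul (hf : DifferentiableAt ℝ f y) (hh : DifferentiableAt ℝ h y) :
    pd i (fun z ↦ f z * h z) y = pd i f y * h y + f y * pd i h y := by
  rw [pd, fderiv_fun_mul hf hh]
  simp only [pd, add_apply, smul_apply, smul_eq_mul]
  ring

theorem pd_const_mul (c : ℝ) (hf : DifferentiableAt ℝ f y) :
    pd i (fun z ↦ c * f z) y = c * pd i f y := by
  rw [pd, fderiv_const_mul hf]; rfl

theorem pd_const (c : ℝ) : pd i (fun _ ↦ c) y = 0 := by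
  simp [pd]

theorem pd_sum {α : Type} {s : Finset α} {F : α → EuclideanSpace ℝ (Fin n) → ℝ}
    (hF : ∀ a ∈ s, DifferentiableAt ℝ (F a) y) :
    pd i (fun z ↦ ∑ a ∈ s, F a z) y = ∑ a ∈ s, pd i (F a) y := by
  rw [pd, fderiv_fun_sum hF, sum_apply]; rfl

theorem pd_congr {U : Set (EuclideanSpace ℝ (Fin n))} (hU : IsOpen U) (hy : y ∈ U)
    (hfh : ∀ z ∈ U, f z = h z) : pd i f y = pd i h y := by
  rw [pd, Filter.EventuallyEq.fderiv_eq (Filter.mem_of_superset (hU.mem_nhds hy) hfh)]; rfl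

theorem contDiffOn_pd {U : Set (EuclideanSpace ℝ (Fin n))} (hU : IsOpen U)
    (hf : ContDiffOn ℝ ∞ f U) : ContDiffOn ℝ ∞ (pd i f) U :=
  (hf.fderiv_of_isOpen hU (m := ∞) (by simp)).clm_apply contDiffOn_const

theorem differentiableAt_of_contDiffOn {U : Set (EuclideanSpace ℝ (Fin n))} (hU : IsOpen U)
    (hf : ContDiffOn ℝ ∞ f U) (hy : y ∈ U) : DifferentiableAt ℝ f y :=
  (hf.contDiffAt (hU.mem_nhds hy)).differentiableAt (by simp)

theorem pd_comm {U : Set (EuclideanSpace ℝ (Fin n))} (hU : IsOpen U)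
    (hf : ContDiffOn ℝ ∞ f U) (hy : y ∈ U) : pd i (pd j f) y = pd j (pd i f) y := by
  have hd : DifferentiableAt ℝ (fderiv ℝ f) y :=
    ((hf.fderiv_of_isOpen hU (m := ∞) (by simp)).contDiffAt (hU.mem_nhds hy)).differentiableAt
      (by simp)
  have key : ∀ i j : Fin n, pd i (pd j f) y =
      fderiv ℝ (fderiv ℝ f) y (EuclideanSpace.single i 1) (EuclideanSpace.single j 1) := by
    intro i j
    change fderiv ℝ (fun z ↦ fderiv ℝ f z (EuclideanSpace.single j (1 : ℝ))) y _ = _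
    rw [fderiv_clm_apply hd (differentiableAt_const _)]
    simp
  rw [key, key]
  exact (hf.contDiffAt (hU.mem_nhds hy)).isSymmSndFDerivAt
    (by rw [minSmoothness_of_isRCLikeNormedField]; exact ENat.LEInfty.out) _ _

/-- The partial derivative of a matrix-valued function. -/
def pdM (M : EuclideanSpace ℝ (Fin n) → Matrix (Fin n) (Fin n) ℝ) (y : EuclideanSpace ℝ (Fin n)) :
    Matrix (Fin n) (Fin n) ℝ :=
  Matrix.of fun k l ↦ pd i (fun z ↦ M z k l) y

/-- Smoothness of a matrix-valued function, in terms of its entries. -/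
def SmoothMatOn (M : EuclideanSpace ℝ (Fin n) → Matrix (Fin n) (Fin n) ℝ)
    (U : Set (EuclideanSpace ℝ (Fin n))) : Prop :=
  ∀ k l, ContDiffOn ℝ ∞ (fun z ↦ M z k l) U

variable {U : Set (EuclideanSpace ℝ (Fin n))}
  {M N : EuclideanSpace ℝ (Fin n) → Matrix (Fin n) (Fin n) ℝ}

theorem SmoothMatOn.mul (hM : SmoothMatOn M U) (hN : SmoothMatOn N U) :
    SmoothMatOn (fun z ↦ M z * N z) U := fun k l ↦ by
  simp only [Matrix.mul_apply]
  exact ContDiffOn.sum fun m _ ↦ (hM k m).mul (hN m l)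

theorem SmoothMatOn.add (hM : SmoothMatOn M U) (hN : SmoothMatOn N U) :
    SmoothMatOn (fun z ↦ M z + N z) U := fun k l ↦ (hM k l).add (hN k l)

theorem SmoothMatOn.sub (hM : SmoothMatOn M U) (hN : SmoothMatOn N U) :
    SmoothMatOn (fun z ↦ M z - N z) U := fun k l ↦ (hM k l).sub (hN k l)

theorem SmoothMatOn.transpose (hM : SmoothMatOn M U) :
    SmoothMatOn (fun z ↦ (M z)ᵀ) U := fun k l ↦ hM l k

theorem SmoothMatOn.pdM (hU : IsOpen U) (hM : SmoothMatOn M U) : SmoothMatOn (pdM i M) U :=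
  fun k l ↦ contDiffOn_pd i hU (hM k l)

theorem contDiffOn_det {ι : Type} [Fintype ι] [DecidableEq ι]
    {M : EuclideanSpace ℝ (Fin n) → Matrix ι ι ℝ} (hM : ∀ k l, ContDiffOn ℝ ∞ (fun z ↦ M z k l) U) :
    ContDiffOn ℝ ∞ (fun z ↦ (M z).det) U := by
  simp only [Matrix.det_apply']
  exact ContDiffOn.sum fun σ _ ↦ contDiffOn_const.mul (contDiffOn_prod fun a _ ↦ hM _ _)

theorem SmoothMatOn.inv (hM : SmoothMatOn M U) (hdet : ∀ z ∈ U, (M z).det ≠ 0) :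
    SmoothMatOn (fun z ↦ (M z)⁻¹) U := fun k l ↦ by
  have h : ∀ z, (M z)⁻¹ k l = ((M z).det)⁻¹ * ((M z).updateRow l (Pi.single k 1)).det := by
    intro z
    rw [Matrix.inv_def, Matrix.smul_apply, Matrix.adjugate_apply, Ring.inverse_eq_inv', smul_eq_mul]
  simp only [h]
  refine ((contDiffOn_det hM).inv hdet).mul (contDiffOn_det fun a b ↦ ?_)
  by_cases ha : a = l
  · subst ha
    simpa using contDiffOn_const
  · simpa [ha] using hM a b

theorem pdM_mul (hU : IsOpen U) (hy : y ∈ U) (hM : SmoothMatOn M U) (hN : SmoothMatOn N U) :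
    pdM i (fun z ↦ M z * N z) y = pdM i M y * N y + M y * pdM i N y := by
  ext k l
  have hM' := fun a b ↦ differentiableAt_of_contDiffOn hU (hM a b) hy
  have hN' := fun a b ↦ differentiableAt_of_contDiffOn hU (hN a b) hy
  simp only [pdM, Matrix.of_apply, Matrix.add_apply, Matrix.mul_apply]
  rw [pd_sum i fun m _ ↦ (hM' k m).fun_mul (hN' m l), ← Finset.sum_add_distrib]
  exact Finset.sum_congr rfl fun m _ ↦ pd_mul i (hM' k m) (hN' m l)

theorem pdM_add (hU : IsOpen U) (hy : y ∈ U) (hM : SmoothMatOn M U) (hN : SmoothMatOn N U) :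
    pdM i (fun z ↦ M z + N z) y = pdM i M y + pdM i N y := by
  ext k l
  exact pd_add i (differentiableAt_of_contDiffOn hU (hM k l) hy)
    (differentiableAt_of_contDiffOn hU (hN k l) hy)

theorem pdM_sub (hU : IsOpen U) (hy : y ∈ U) (hM : SmoothMatOn M U) (hN : SmoothMatOn N U) :
    pdM i (fun z ↦ M z - N z) y = pdM i M y - pdM i N y := by
  ext k l
  exact pd_sub i (differentiableAt_of_contDiffOn hU (hM k l) hy)
    (differentiableAt_of_contDiffOn hU (hN k l) hy)

theorem pdM_transpose : pdM i (fun z ↦ (M z)ᵀ) y = (pdM i M y)ᵀ := rfl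

theorem pdM_comm (hU : IsOpen U) (hy : y ∈ U) (hM : SmoothMatOn M U) :
    pdM i (pdM j M) y = pdM j (pdM i M) y := by
  ext k l
  exact pd_comm i j hU (hM k l) hy

theorem pdM_congr (hU : IsOpen U) (hy : y ∈ U) (hMN : ∀ z ∈ U, M z = N z) :
    pdM i M y = pdM i N y := by
  ext k l
  exact pd_congr i hU hy fun z hz ↦ by rw [hMN z hz]

end PartialDerivatives

/-! ### The Levi-Civita connection in matrix form -/

/-- A matrix-valued function on an open set that is the matrix of a pseudo-Riemannian metric. -/
structure IsMetricOn (g : EuclideanSpace ℝ (Fin n) → Matrix (Fin n) (Fin n) ℝ)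
    (U : Set (EuclideanSpace ℝ (Fin n))) : Prop where
  isOpen : IsOpen U
  smooth : SmoothMatOn g U
  isSymm : ∀ z ∈ U, (g z).IsSymm
  det_ne_zero : ∀ z ∈ U, (g z).det ≠ 0

/-- The connection matrices `(A_i)^k_l = Γ^k_{il}`. -/
def conn (g : EuclideanSpace ℝ (Fin n) → Matrix (Fin n) (Fin n) ℝ) (i : Fin n)
    (y : EuclideanSpace ℝ (Fin n)) : Matrix (Fin n) (Fin n) ℝ :=
  Matrix.of fun k l ↦ christoffel g k i l y

/-- The curvature matrices `(F_{ij})^k_l = R_{ij}{}^k{}_l`. -/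
def curv (g : EuclideanSpace ℝ (Fin n) → Matrix (Fin n) (Fin n) ℝ) (i j : Fin n)
    (y : EuclideanSpace ℝ (Fin n)) : Matrix (Fin n) (Fin n) ℝ :=
  Matrix.of fun k l ↦ riem g i j k l y

theorem curv_eq (g : EuclideanSpace ℝ (Fin n) → Matrix (Fin n) (Fin n) ℝ) (i j : Fin n) :
    curv g i j = fun y ↦ pdM i (conn g j) y - pdM j (conn g i) y +
      conn g i y * conn g j y - conn g j y * conn g i y := by
  ext y k l
  simp only [curv, conn, pdM, Matrix.of_apply, Matrix.add_apply, Matrix.sub_apply,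
    Matrix.mul_apply, riem]

theorem curv_antisymm (g : EuclideanSpace ℝ (Fin n) → Matrix (Fin n) (Fin n) ℝ) (i j : Fin n)
    (y : EuclideanSpace ℝ (Fin n)) : curv g i j y = -curv g j i y := by
  simp only [curv_eq]
  abel

namespace IsMetricOn

variable {g : EuclideanSpace ℝ (Fin n) → Matrix (Fin n) (Fin n) ℝ}
  {U : Set (EuclideanSpace ℝ (Fin n))} {y : EuclideanSpace ℝ (Fin n)}

theorem mul_inv (hg : IsMetricOn g U) (hy : y ∈ U) : g y * (g y)⁻¹ = 1 :=
  Matrix.mul_nonsing_inv _ (isUnit_iff_ne_zero.2 (hg.det_ne_zero y hy))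

theorem inv_mul (hg : IsMetricOn g U) (hy : y ∈ U) : (g y)⁻¹ * g y = 1 :=
  Matrix.nonsing_inv_mul _ (isUnit_iff_ne_zero.2 (hg.det_ne_zero y hy))

theorem inv_isSymm (hg : IsMetricOn g U) (hy : y ∈ U) : ((g y)⁻¹).IsSymm := by
  rw [Matrix.IsSymm, Matrix.transpose_nonsing_inv, (hg.isSymm y hy).eq]

theorem smooth_inv (hg : IsMetricOn g U) : SmoothMatOn (fun z ↦ (g z)⁻¹) U :=
  hg.smooth.inv hg.det_ne_zero

theorem pd_symm (hg : IsMetricOn g U) (hy : y ∈ U) (i j k : Fin n) :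
    pd i (fun z ↦ g z j k) y = pd i (fun z ↦ g z k j) y :=
  pd_congr i hg.isOpen hy fun z hz ↦ (hg.isSymm z hz).apply _ _

theorem contDiffOn_christoffel (hg : IsMetricOn g U) (k i j : Fin n) :
    ContDiffOn ℝ ∞ (christoffel g k i j) U := by
  unfold christoffel
  exact contDiffOn_const.mul <| ContDiffOn.sum fun l _ ↦ (hg.smooth_inv k l).mul <|
    ((contDiffOn_pd i hg.isOpen (hg.smooth j l)).add
      (contDiffOn_pd j hg.isOpen (hg.smooth i l))).sub (contDiffOn_pd l hg.isOpen (hg.smooth i j))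

theorem smooth_conn (hg : IsMetricOn g U) (i : Fin n) : SmoothMatOn (conn g i) U :=
  fun k l ↦ hg.contDiffOn_christoffel k i l

theorem christoffel_symm (hg : IsMetricOn g U) (hy : y ∈ U) (k i j : Fin n) :
    christoffel g k i j y = christoffel g k j i y := by
  unfold christoffel
  congr 1
  refine Finset.sum_congr rfl fun l _ ↦ ?_
  rw [hg.pd_symm hy l i j]
  ring

/-- The Christoffel symbols of the first kind. -/
theorem mul_conn_apply (hg : IsMetricOn g U) (hy : y ∈ U) (a j i : Fin n) :
    (g y * conn g a y) j i = 1 / 2 *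
      (pd a (fun z ↦ g z i j) y + pd i (fun z ↦ g z a j) y - pd j (fun z ↦ g z a i) y) := by
  set B : Matrix (Fin n) (Fin n) ℝ := Matrix.of fun j i ↦ 1 / 2 *
      (pd a (fun z ↦ g z i j) y + pd i (fun z ↦ g z a j) y - pd j (fun z ↦ g z a i) y) with hB
  have : conn g a y = (g y)⁻¹ * B := by
    ext k l
    simp only [conn, christoffel, hB, Matrix.of_apply, Matrix.mul_apply, Finset.mul_sum]
    exact Finset.sum_congr rfl fun m _ ↦ by ring
  rw [this, ← mul_assoc, hg.mul_inv hy, one_mul]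
  rfl

/-- The Levi-Civita connection is compatible with the metric: `∇g = 0`. -/
theorem pdM_metric (hg : IsMetricOn g U) (hy : y ∈ U) (a : Fin n) :
    pdM a g y = (conn g a y)ᵀ * g y + g y * conn g a y := by
  have h : (conn g a y)ᵀ * g y = (g y * conn g a y)ᵀ := by
    rw [Matrix.transpose_mul, (hg.isSymm y hy).eq]
  ext i j
  rw [h, Matrix.add_apply, Matrix.transpose_apply, hg.mul_conn_apply hy, hg.mul_conn_apply hy,
    pdM, Matrix.of_apply, hg.pd_symm hy a j i]
  ring

/-- The inverse metric is parallel: `∇g⁻¹ = 0`. -/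
theorem pdM_inv (hg : IsMetricOn g U) (hy : y ∈ U) (a : Fin n) :
    pdM a (fun z ↦ (g z)⁻¹) y = -(conn g a y * (g y)⁻¹ + (g y)⁻¹ * (conn g a y)ᵀ) := by
  have h1 : pdM a (fun z ↦ (g z)⁻¹ * g z) y = 0 := by
    rw [pdM_congr a hg.isOpen hy (N := fun _ ↦ 1) fun z hz ↦ hg.inv_mul hz]
    ext k l
    exact pd_const a _
  rw [pdM_mul a hg.isOpen hy hg.smooth_inv hg.smooth, hg.pdM_metric hy] at h1
  have h2 := congr_arg (· * (g y)⁻¹) h1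
  simp only [add_mul, mul_add, zero_mul] at h2
  have e1 : pdM a (fun z ↦ (g z)⁻¹) y * g y * (g y)⁻¹ = pdM a (fun z ↦ (g z)⁻¹) y := by
    rw [mul_assoc, hg.mul_inv hy, mul_one]
  have e2 : (g y)⁻¹ * ((conn g a y)ᵀ * g y) * (g y)⁻¹ = (g y)⁻¹ * (conn g a y)ᵀ := by
    rw [mul_assoc, mul_assoc, hg.mul_inv hy, mul_one]
  have e3 : (g y)⁻¹ * (g y * conn g a y) * (g y)⁻¹ = conn g a y * (g y)⁻¹ := by
    rw [← mul_assoc (g y)⁻¹, hg.inv_mul hy, one_mul]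
  rw [e1, e2, e3] at h2
  rw [eq_neg_iff_add_eq_zero, ← h2]
  abel

theorem smooth_curv (hg : IsMetricOn g U) (i j : Fin n) : SmoothMatOn (curv g i j) U := by
  rw [curv_eq]
  exact ((((hg.smooth_conn j).pdM i hg.isOpen).sub ((hg.smooth_conn i).pdM j hg.isOpen)).add
    ((hg.smooth_conn i).mul (hg.smooth_conn j))).sub ((hg.smooth_conn j).mul (hg.smooth_conn i))

theorem pdM_curv (hg : IsMetricOn g U) (hy : y ∈ U) (a i j : Fin n) :
    pdM a (curv g i j) y = pdM a (pdM i (conn g j)) y - pdM a (pdM j (conn g i)) y +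
      (pdM a (conn g i) y * conn g j y + conn g i y * pdM a (conn g j) y) -
      (pdM a (conn g j) y * conn g i y + conn g j y * pdM a (conn g i) y) := by
  have hA := hg.smooth_conn
  have hdA := fun i j ↦ (hA j).pdM i hg.isOpen
  rw [curv_eq, pdM_sub a hg.isOpen hy (((hdA i j).sub (hdA j i)).add ((hA i).mul (hA j)))
    ((hA j).mul (hA i)), pdM_add a hg.isOpen hy ((hdA i j).sub (hdA j i)) ((hA i).mul (hA j)),
    pdM_sub a hg.isOpen hy (hdA i j) (hdA j i), pdM_mul a hg.isOpen hy (hA i) (hA j),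
    pdM_mul a hg.isOpen hy (hA j) (hA i)]

/-- The second Bianchi identity. The indices `a`, `b`, `c` themselves are not differentiated
covariantly; the terms this omits cancel, see `bianchi_second_raised`. -/
theorem bianchi_second (hg : IsMetricOn g U) (hy : y ∈ U) (a b c : Fin n) :
    (pdM a (curv g b c) y + conn g a y * curv g b c y - curv g b c y * conn g a y) +
    (pdM b (curv g c a) y + conn g b y * curv g c a y - curv g c a y * conn g b y) +
    (pdM c (curv g a b) y + conn g c y * curv g a b y - curv g a b y * conn g c y) = 0 := by
  simp only [hg.pdM_curv hy]
  simp only [curv_eq]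
  rw [pdM_comm b a hg.isOpen hy (hg.smooth_conn c), pdM_comm c a hg.isOpen hy (hg.smooth_conn b),
    pdM_comm c b hg.isOpen hy (hg.smooth_conn a)]
  noncomm_ring

/-- The curvature of a metric connection takes values in the skew endomorphisms: it is the obstruction
to the commutation of second derivatives of the metric. -/
theorem curv_skew (hg : IsMetricOn g U) (hy : y ∈ U) (a b : Fin n) :
    (curv g a b y)ᵀ * g y + g y * curv g a b y = 0 := by
  have hA := hg.smooth_conn
  have h : ∀ a b, pdM a (pdM b g) y =
      (pdM a (conn g b) y)ᵀ * g y + (conn g b y)ᵀ * ((conn g a y)ᵀ * g y + g y * conn g a y) +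
      (((conn g a y)ᵀ * g y + g y * conn g a y) * conn g b y + g y * pdM a (conn g b) y) := by
    intro a b
    rw [pdM_congr a hg.isOpen hy (N := fun z ↦ (conn g b z)ᵀ * g z + g z * conn g b z)
      fun z hz ↦ hg.pdM_metric hz b,
      pdM_add a hg.isOpen hy ((hA b).transpose.mul hg.smooth) (hg.smooth.mul (hA b)),
      pdM_mul a hg.isOpen hy (hA b).transpose hg.smooth,
      pdM_mul a hg.isOpen hy hg.smooth (hA b), pdM_transpose, hg.pdM_metric hy]
  have h2 := pdM_comm a b hg.isOpen hy hg.smooth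
  rw [h, h, ← sub_eq_zero] at h2
  rw [← h2, curv_eq]
  simp only [Matrix.transpose_add, Matrix.transpose_sub, Matrix.transpose_mul]
  noncomm_ring

/-! ### Symmetries of the curvature -/

theorem riemLow_eq (y : EuclideanSpace ℝ (Fin n)) (i j k l : Fin n) :
    riemLow g i j k l y = (g y * curv g i j y) k l := by
  rw [Matrix.mul_apply]; rfl

theorem riemLow_antisymm_left (y : EuclideanSpace ℝ (Fin n)) (i j k l : Fin n) :
    riemLow g i j k l y = -riemLow g j i k l y := by
  rw [riemLow_eq, riemLow_eq, curv_antisymm, mul_neg]; rfl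

theorem riemLow_antisymm_right (hg : IsMetricOn g U) (hy : y ∈ U) (i j k l : Fin n) :
    riemLow g i j k l y = -riemLow g i j l k y := by
  have h := congr_fun (congr_fun (hg.curv_skew hy i j) k) l
  have h2 : (curv g i j y)ᵀ * g y = (g y * curv g i j y)ᵀ := by
    rw [Matrix.transpose_mul, (hg.isSymm y hy).eq]
  rw [h2, Matrix.add_apply, Matrix.transpose_apply, ← riemLow_eq, ← riemLow_eq,
    Matrix.zero_apply] at h
  linarith

/-- The first Bianchi identity, a consequence of the connection being torsion-free. -/
theorem bianchi_first (hg : IsMetricOn g U) (hy : y ∈ U) (i j k l : Fin n) :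
    riem g i j k l y + riem g j l k i y + riem g l i k j y = 0 := by
  have hs : ∀ a i j, pd a (christoffel g k i j) y = pd a (christoffel g k j i) y := fun a i j ↦
    pd_congr a hg.isOpen hy fun z hz ↦ hg.christoffel_symm hz k i j
  have hs2 := hg.christoffel_symm hy
  simp only [riem]
  rw [hs l i j, hs j l i, hs i l j]
  simp only [hs2 _ l i, hs2 _ l j, hs2 _ j i]
  ring

theorem bianchi_first_low (hg : IsMetricOn g U) (hy : y ∈ U) (i j k l : Fin n) :
    riemLow g i j k l y + riemLow g j l k i y + riemLow g l i k j y = 0 := by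
  simp only [riemLow, ← Finset.sum_add_distrib, ← mul_add, hg.bianchi_first hy, mul_zero,
    Finset.sum_const_zero]

/-- The pair symmetry follows from the two antisymmetries and four instances of the first Bianchi
identity. -/
theorem riemLow_pair_symm (hg : IsMetricOn g U) (hy : y ∈ U) (i j k l : Fin n) :
    riemLow g i j k l y = riemLow g k l i j y := by
  have b := hg.bianchi_first_low hy
  have l1 := riemLow_antisymm_left (g := g) y
  have r1 := hg.riemLow_antisymm_right hy
  linarith [b i j k l, b j k l i, b k l i j, b l i j k, l1 i j k l, l1 j l k i, l1 l i k j,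
    r1 i j k l, r1 j l k i, r1 l i k j, l1 j k l i, l1 k i l j, l1 i j l k, r1 j k l i, r1 k i l j,
    l1 k l i j, l1 l j i k, l1 j k i l, r1 k l i j, r1 l j i k, r1 j k i l, l1 l i j k, l1 i k j l,
    l1 k l j i, r1 l i j k, r1 i k j l, r1 k l j i]

theorem riem_eq_sum (hg : IsMetricOn g U) (hy : y ∈ U) (i j k l : Fin n) :
    riem g i j k l y = ∑ m, (g y)⁻¹ k m * riemLow g i j m l y := by
  simp only [riemLow_eq, ← Matrix.mul_apply]
  rw [← mul_assoc, hg.inv_mul hy, one_mul]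
  rfl

theorem ricci_symm (hg : IsMetricOn g U) (hy : y ∈ U) (i j : Fin n) :
    ricci g i j y = ricci g j i y := by
  simp only [ricci, hg.riem_eq_sum hy]
  rw [Finset.sum_comm]
  refine Finset.sum_congr rfl fun k _ ↦ Finset.sum_congr rfl fun m _ ↦ ?_
  rw [hg.riemLow_pair_symm hy, (hg.inv_isSymm hy).apply]

theorem schouten_symm (hg : IsMetricOn g U) (hy : y ∈ U) (i j : Fin n) :
    schouten g i j y = schouten g j i y := by
  rw [schouten, schouten, hg.ricci_symm hy, (hg.isSymm y hy).apply]

theorem weylLow_pair_symm (hg : IsMetricOn g U) (hy : y ∈ U) (i j k l : Fin n) :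
    weylLow g i j k l y = weylLow g k l i j y := by
  have hP := hg.schouten_symm hy
  have hs := fun i j ↦ (hg.isSymm y hy).apply i j
  rw [weylLow, weylLow, hg.riemLow_pair_symm hy, hP i k, hP i l, hP j l, hP j k, hs j l, hs j k,
    hs i k, hs i l]
  ring

/-! ### Smoothness of the curvature tensors -/

theorem contDiffOn_riem (hg : IsMetricOn g U) (i j k l : Fin n) :
    ContDiffOn ℝ ∞ (riem g i j k l) U := hg.smooth_curv i j k l

theorem contDiffOn_riemLow (hg : IsMetricOn g U) (i j k l : Fin n) :
    ContDiffOn ℝ ∞ (riemLow g i j k l) U :=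
  ContDiffOn.sum fun m _ ↦ (hg.smooth k m).mul (hg.contDiffOn_riem i j m l)

theorem contDiffOn_ricci (hg : IsMetricOn g U) (i j : Fin n) :
    ContDiffOn ℝ ∞ (ricci g i j) U :=
  ContDiffOn.sum fun k _ ↦ hg.contDiffOn_riem k i k j

theorem contDiffOn_scal (hg : IsMetricOn g U) : ContDiffOn ℝ ∞ (scal g) U :=
  ContDiffOn.sum fun i _ ↦ ContDiffOn.sum fun j _ ↦
    (hg.smooth_inv i j).mul (hg.contDiffOn_ricci i j)

theorem contDiffOn_schouten (hg : IsMetricOn g U) (i j : Fin n) :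
    ContDiffOn ℝ ∞ (schouten g i j) U :=
  contDiffOn_const.mul ((hg.contDiffOn_ricci i j).sub
    ((hg.contDiffOn_scal.div_const _).mul (hg.smooth i j)))

theorem contDiffOn_weylLow (hg : IsMetricOn g U) (i j k l : Fin n) :
    ContDiffOn ℝ ∞ (weylLow g i j k l) U := by
  have hP := hg.contDiffOn_schouten
  have hs := hg.smooth
  exact (hg.contDiffOn_riemLow i j k l).sub (((((hP i k).mul (hs j l)).sub
    ((hP i l).mul (hs j k))).add ((hP j l).mul (hs i k))).sub ((hP j k).mul (hs i l)))

theorem contDiffOn_raise34 (hg : IsMetricOn g U)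
    {T : Fin n → Fin n → Fin n → Fin n → EuclideanSpace ℝ (Fin n) → ℝ}
    (hT : ∀ i j k l, ContDiffOn ℝ ∞ (T i j k l) U) (i j k l : Fin n) :
    ContDiffOn ℝ ∞ (raise34 g T i j k l) U :=
  ContDiffOn.sum fun p _ ↦ ContDiffOn.sum fun q _ ↦
    ((hg.smooth_inv k p).mul (hg.smooth_inv l q)).mul (hT i j p q)

theorem contDiffOn_schoutenUp (hg : IsMetricOn g U) (j i : Fin n) :
    ContDiffOn ℝ ∞ (schoutenUp g j i) U :=
  ContDiffOn.sum fun p _ ↦ (hg.smooth_inv i p).mul (hg.contDiffOn_schouten j p)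

end IsMetricOn

/-! ### Covariant differentiation of tensors as polynomials -/

/-- `F'` is the `a`-th partial derivative at `y` of the function `F` with values in the polynomial
ring, in the sense that `F` takes values in the span of finitely many elements with coefficients
differentiable at `y`, and `F'` is obtained by differentiating the coefficients. -/
def HasPartial (a : Fin n) (F : EuclideanSpace ℝ (Fin n) → MvPolynomial (Fin n × Fin n) ℝ)
    (F' : MvPolynomial (Fin n × Fin n) ℝ) (y : EuclideanSpace ℝ (Fin n)) : Prop :=
  ∃ (ι : Type) (_ : Fintype ι) (f : ι → EuclideanSpace ℝ (Fin n) → ℝ)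
    (b : ι → MvPolynomial (Fin n × Fin n) ℝ), (∀ s, DifferentiableAt ℝ (f s) y) ∧
    (∀ z, F z = ∑ s, f s z • b s) ∧ F' = ∑ s, pd a (f s) y • b s

namespace HasPartial

variable {a : Fin n} {F G : EuclideanSpace ℝ (Fin n) → MvPolynomial (Fin n × Fin n) ℝ}
  {F' G' : MvPolynomial (Fin n × Fin n) ℝ} {y : EuclideanSpace ℝ (Fin n)}

theorem const (b : MvPolynomial (Fin n × Fin n) ℝ) : HasPartial a (fun _ ↦ b) 0 y :=
  ⟨Unit, inferInstance, fun _ _ ↦ 1, fun _ ↦ b, fun _ ↦ differentiableAt_const _,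
    fun _ ↦ by simp, by simp [pd_const]⟩

theorem mul (hF : HasPartial a F F' y) (hG : HasPartial a G G' y) :
    HasPartial a (fun z ↦ F z * G z) (F y * G' + G y * F') y := by
  obtain ⟨ι, _, f, b, hf, hFf, rfl⟩ := hF
  obtain ⟨κ, _, h, c, hh, hGh, rfl⟩ := hG
  refine ⟨ι × κ, inferInstance, fun s z ↦ f s.1 z * h s.2 z, fun s ↦ b s.1 * c s.2,
    fun s ↦ (hf s.1).fun_mul (hh s.2), fun z ↦ ?_, ?_⟩
  · beta_reduce
    rw [hFf, hGh, Finset.sum_mul_sum, Fintype.sum_prod_type]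
    simp only [smul_mul_smul_comm]
  · rw [hFf, hGh, Fintype.sum_prod_type, mul_comm (∑ s, h s y • c s), Finset.sum_mul_sum,
      Finset.sum_mul_sum, ← Finset.sum_add_distrib]
    refine Finset.sum_congr rfl fun s _ ↦ ?_
    rw [← Finset.sum_add_distrib]
    refine Finset.sum_congr rfl fun t _ ↦ ?_
    rw [pd_mul a (hf s) (hh t), smul_mul_smul_comm, smul_mul_smul_comm, ← add_smul, add_comm]

theorem pow (hF : HasPartial a F F' y) (m : ℕ) :
    HasPartial a (fun z ↦ F z ^ m)
      ((m : MvPolynomial (Fin n × Fin n) ℝ) * (F y ^ (m - 1) * F')) y := by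
  induction m with
  | zero => simpa using const 1
  | succ m ih =>
    have h := hF.mul ih
    simp only [pow_succ']
    convert h using 1
    cases m with
    | zero => simp
    | succ m =>
      simp only [Nat.add_sub_cancel]
      push_cast
      ring

theorem const_smul (c : ℝ) (hF : HasPartial a F F' y) :
    HasPartial a (fun z ↦ c • F z) (c • F') y := by
  obtain ⟨ι, _, f, b, hf, hFf, rfl⟩ := hF
  refine ⟨ι, inferInstance, f, fun s ↦ c • b s, hf, fun z ↦ ?_, ?_⟩
  · beta_reduce
    rw [hFf, Finset.smul_sum]
    simp only [smul_comm c]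
  · rw [Finset.smul_sum]
    simp only [smul_comm c]

theorem add (hF : HasPartial a F F' y) (hG : HasPartial a G G' y) :
    HasPartial a (fun z ↦ F z + G z) (F' + G') y := by
  obtain ⟨ι, _, f, b, hf, hFf, rfl⟩ := hF
  obtain ⟨κ, _, h, c, hh, hGh, rfl⟩ := hG
  refine ⟨ι ⊕ κ, inferInstance, Sum.elim f h, Sum.elim b c, ?_, fun z ↦ ?_, ?_⟩
  · rintro (s | s)
    exacts [hf s, hh s]
  · simp [hFf, hGh]
  · simp

theorem sum {α : Type} (s : Finset α)
    {F : α → EuclideanSpace ℝ (Fin n) → MvPolynomial (Fin n × Fin n) ℝ}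
    {F' : α → MvPolynomial (Fin n × Fin n) ℝ} (hF : ∀ t ∈ s, HasPartial a (F t) (F' t) y) :
    HasPartial a (fun z ↦ ∑ t ∈ s, F t z) (∑ t ∈ s, F' t) y := by
  classical
  induction s using Finset.induction_on with
  | empty => simpa using const 0
  | insert t s ht ih =>
    simp only [Finset.sum_insert ht]
    exact (hF t (Finset.mem_insert_self t s)).add
      (ih fun u hu ↦ hF u (Finset.mem_insert_of_mem hu))

theorem smul_const {f : EuclideanSpace ℝ (Fin n) → ℝ} (hf : DifferentiableAt ℝ f y)
    (b : MvPolynomial (Fin n × Fin n) ℝ) : HasPartial a (fun z ↦ f z • b) (pd a f y • b) y :=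
  ⟨Unit, inferInstance, fun _ ↦ f, fun _ ↦ b, fun _ ↦ hf, fun _ ↦ by simp, by simp⟩

theorem elt2 {T : Fin n → Fin n → EuclideanSpace ℝ (Fin n) → ℝ}
    (hT : ∀ j i, DifferentiableAt ℝ (T j i) y) :
    HasPartial a (fun z ↦ elt2 fun j i ↦ T j i z) (elt2 fun j i ↦ pd a (T j i) y) y :=
  sum _ fun _ _ ↦ sum _ fun _ _ ↦ smul_const (hT _ _) _

theorem elt4 {T : Fin n → Fin n → Fin n → Fin n → EuclideanSpace ℝ (Fin n) → ℝ}
    (hT : ∀ j l i k, DifferentiableAt ℝ (T j l i k) y) :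
    HasPartial a (fun z ↦ elt4 fun j l i k ↦ T j l i k z)
      (elt4 fun j l i k ↦ pd a (T j l i k) y) y :=
  sum _ fun _ _ ↦ sum _ fun _ _ ↦ sum _ fun _ _ ↦ sum _ fun _ _ ↦ smul_const (hT _ _ _ _) _

theorem omegaElt (k : ℕ) (hF : HasPartial a F F' y) (hG : HasPartial a G G' y) :
    HasPartial a (fun z ↦ omegaElt k (F z) (G z)) (omegaEltDeriv k (F y) (G y) F' G') y :=
  sum _ fun _ _ ↦ const_smul _ ((hF.pow _).mul (hG.pow _))

theorem pd_linearMap (hF : HasPartial a F F' y) (φ : MvPolynomial (Fin n × Fin n) ℝ →ₗ[ℝ] ℝ) :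
    pd a (fun z ↦ φ (F z)) y = φ F' := by
  obtain ⟨ι, _, f, b, hf, hFf, rfl⟩ := hF
  simp only [hFf, map_sum, map_smul, smul_eq_mul]
  rw [pd_sum a fun s _ ↦ (hf s).mul_const _]
  refine Finset.sum_congr rfl fun s _ ↦ ?_
  rw [pd_mul a (hf s) (differentiableAt_const _), pd_const, mul_zero, add_zero]

end HasPartial

theorem glDer_idElt (A : Matrix (Fin n) (Fin n) ℝ) : glDer A (idElt n) = 0 := by
  simp only [idElt, map_sum, glDer_X, Finset.sum_sub_distrib]
  rw [sub_eq_zero]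
  exact Finset.sum_comm

section SumSwap

variable {V : Type} [AddCommMonoid V]

theorem sum_swap_first_third (F : Fin n → Fin n → Fin n → V) :
    ∑ i, ∑ k, ∑ m, F i k m = ∑ i, ∑ k, ∑ m, F m k i := by
  rw [Finset.sum_comm]
  refine (Finset.sum_congr rfl fun k _ ↦ Finset.sum_comm).trans ?_
  exact Finset.sum_comm

theorem sum_swap_first_fourth (F : Fin n → Fin n → Fin n → Fin n → V) :
    ∑ l, ∑ i, ∑ k, ∑ m, F l i k m = ∑ l, ∑ i, ∑ k, ∑ m, F m i k l := by
  rw [Finset.sum_comm]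
  refine (Finset.sum_congr rfl fun k _ ↦ sum_swap_first_third _).trans ?_
  exact Finset.sum_comm

theorem sum_swap_first_fifth (F : Fin n → Fin n → Fin n → Fin n → Fin n → V) :
    ∑ j, ∑ l, ∑ i, ∑ k, ∑ m, F j l i k m = ∑ j, ∑ l, ∑ i, ∑ k, ∑ m, F m l i k j := by
  rw [Finset.sum_comm]
  refine (Finset.sum_congr rfl fun k _ ↦ sum_swap_first_fourth _).trans ?_
  exact Finset.sum_comm

end SumSwap

/-- The action of `gl(n)` on polynomials induces its action on tensors, so that `glDer (conn g a y)`
produces the terms with Christoffel symbols of a covariant derivative. -/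
theorem glDer_elt2 (A : Matrix (Fin n) (Fin n) ℝ) (T : Fin n → Fin n → ℝ) :
    glDer A (elt2 T) = elt2 fun j i ↦ ∑ m, A i m * T j m - ∑ m, A m j * T m i := by
  simp only [elt2, map_sum, Derivation.map_smul, glDer_X, Finset.smul_sum, sub_smul,
    Finset.sum_smul, smul_sub, Finset.sum_sub_distrib, smul_smul]
  congr 1
  · refine Finset.sum_congr rfl fun j _ ↦ ?_
    rw [Finset.sum_comm]
    simp only [mul_comm]
  · rw [sum_swap_first_third]
    simp only [mul_comm]

theorem glDer_elt4 (A : Matrix (Fin n) (Fin n) ℝ) (T : Fin n → Fin n → Fin n → Fin n → ℝ) :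
    glDer A (elt4 T) = elt4 fun j l i k ↦ ∑ m, A i m * T j l m k + ∑ m, A k m * T j l i m -
      ∑ m, A m j * T m l i k - ∑ m, A m l * T j m i k := by
  have h : ∀ j l i k, glDer A (T j l i k • (X (i, j) * X (k, l))) =
      ∑ m, (A m i * T j l i k) • (X (m, j) * X (k, l)) +
      ∑ m, (A m k * T j l i k) • (X (i, j) * X (m, l)) -
      ∑ m, (A j m * T j l i k) • (X (i, m) * X (k, l)) -
      ∑ m, (A l m * T j l i k) • (X (i, j) * X (k, m)) := by
    intro j l i k
    rw [Derivation.map_smul, Derivation.leibniz, glDer_X, glDer_X, Finset.sum_sub_distrib,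
      Finset.sum_sub_distrib, smul_eq_mul, smul_eq_mul, mul_sub, mul_sub]
    simp only [Finset.mul_sum, mul_smul_comm, smul_add, smul_sub, Finset.smul_sum, smul_smul,
      mul_comm (T j l i k)]
    simp only [mul_comm (X (k, l))]
    abel
  simp only [elt4, map_sum, h, add_smul, sub_smul, Finset.sum_smul, Finset.sum_add_distrib,
    Finset.sum_sub_distrib]
  refine congrArg₂ (· - ·) (congrArg₂ (· - ·) (congrArg₂ (· + ·) ?_ ?_) ?_) ?_
  · exact Finset.sum_congr rfl fun j _ ↦ Finset.sum_congr rfl fun l _ ↦ sum_swap_first_third _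
  · exact Finset.sum_congr rfl fun j _ ↦ Finset.sum_congr rfl fun l _ ↦
      Finset.sum_congr rfl fun i _ ↦ Finset.sum_comm
  · exact sum_swap_first_fifth _
  · exact Finset.sum_congr rfl fun j _ ↦ sum_swap_first_fourth _

namespace IsMetricOn

variable {g : EuclideanSpace ℝ (Fin n) → Matrix (Fin n) (Fin n) ℝ}
  {U : Set (EuclideanSpace ℝ (Fin n))} {y : EuclideanSpace ℝ (Fin n)}

/-- The covariant derivative commutes with raising an index. -/
theorem covariant_schoutenUp (hg : IsMetricOn g U) (hy : y ∈ U) (a j i : Fin n) :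
    pd a (schoutenUp g j i) y + (∑ m, conn g a y i m * schoutenUp g j m y -
      ∑ m, conn g a y m j * schoutenUp g m i y) =
      ∑ p, (g y)⁻¹ i p * cov2 g (schouten g) a j p y := by
  have hP := fun p ↦ differentiableAt_of_contDiffOn hg.isOpen (hg.contDiffOn_schouten j p) hy
  have hH := fun p ↦ differentiableAt_of_contDiffOn hg.isOpen (hg.smooth_inv i p) hy
  have h1 : pd a (schoutenUp g j i) y = ∑ p, (pd a (fun z ↦ (g z)⁻¹ i p) y * schouten g j p y +
      (g y)⁻¹ i p * pd a (schouten g j p) y) := by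
    unfold schoutenUp
    rw [pd_sum a fun p _ ↦ (hH p).fun_mul (hP p)]
    exact Finset.sum_congr rfl fun p _ ↦ pd_mul a (hH p) (hP p)
  have h2 : ∀ p, pd a (fun z ↦ (g z)⁻¹ i p) y =
      -(∑ m, conn g a y i m * (g y)⁻¹ m p + ∑ m, (g y)⁻¹ i m * conn g a y p m) := fun p ↦ by
    have := congr_fun (congr_fun (hg.pdM_inv hy a) i) p
    rwa [Matrix.neg_apply, Matrix.add_apply, Matrix.mul_apply, Matrix.mul_apply] at this
  have e1 : ∑ m, conn g a y i m * schoutenUp g j m y =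
      ∑ p, (∑ m, conn g a y i m * (g y)⁻¹ m p) * schouten g j p y := by
    simp only [schoutenUp, Finset.mul_sum, Finset.sum_mul, mul_assoc]
    exact Finset.sum_comm
  have e2 : ∑ m, conn g a y m j * schoutenUp g m i y =
      ∑ p, (g y)⁻¹ i p * ∑ m, conn g a y m j * schouten g m p y := by
    simp only [schoutenUp, Finset.mul_sum]
    rw [Finset.sum_comm]
    exact Finset.sum_congr rfl fun p _ ↦ Finset.sum_congr rfl fun m _ ↦ by ring
  have e3 : ∑ p, (∑ m, (g y)⁻¹ i m * conn g a y p m) * schouten g j p y =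
      ∑ p, (g y)⁻¹ i p * ∑ m, conn g a y m p * schouten g j m y := by
    simp only [Finset.mul_sum, Finset.sum_mul]
    rw [Finset.sum_comm]
    exact Finset.sum_congr rfl fun p _ ↦ Finset.sum_congr rfl fun m _ ↦ by ring
  have e4 : ∀ p, cov2 g (schouten g) a j p y = pd a (schouten g j p) y -
      ∑ m, conn g a y m j * schouten g m p y - ∑ m, conn g a y m p * schouten g j m y :=
    fun p ↦ rfl
  simp only [h1, h2, e1, e2, e4, neg_mul, add_mul, mul_sub, Finset.sum_add_distrib,
    Finset.sum_sub_distrib, Finset.sum_neg_distrib, e3]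
  ring

theorem raise34_riemLow (hg : IsMetricOn g U) (hy : y ∈ U) (j l i k : Fin n) :
    raise34 g (riemLow g) j l i k y = (curv g j l y * (g y)⁻¹) i k := by
  have h : (curv g j l y * (g y)⁻¹) =
      (g y)⁻¹ * (g y * curv g j l y) * ((g y)⁻¹)ᵀ := by
    rw [← mul_assoc, hg.inv_mul hy, one_mul, (hg.inv_isSymm hy).eq]
  rw [h, Matrix.mul_apply, raise34, Finset.sum_comm]
  refine Finset.sum_congr rfl fun q _ ↦ ?_
  rw [Matrix.mul_apply, Finset.sum_mul]
  refine Finset.sum_congr rfl fun p _ ↦ ?_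
  rw [riemLow_eq, Matrix.transpose_apply]
  ring

/-- The second Bianchi identity for `R_{jl}{}^{ik}`, with all Christoffel symbols written out. -/
theorem bianchi_second_raised (hg : IsMetricOn g U) (hy : y ∈ U)
    {V : Fin n → Fin n → Fin n → Fin n → Fin n → ℝ}
    (hV : V = fun a j l i k ↦ pd a (raise34 g (riemLow g) j l i k) y +
      (∑ m, conn g a y i m * raise34 g (riemLow g) j l m k y +
        ∑ m, conn g a y k m * raise34 g (riemLow g) j l i m y -
        ∑ m, conn g a y m j * raise34 g (riemLow g) m l i k y -
        ∑ m, conn g a y m l * raise34 g (riemLow g) j m i k y)) (a j l i k : Fin n) :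
    V a j l i k + V j l a i k + V l a j i k = 0 := by
  set S : Fin n → Fin n → Matrix (Fin n) (Fin n) ℝ := fun j l ↦ curv g j l y * (g y)⁻¹ with hS
  have h1 : ∀ a j l, V a j l i k =
      ((pdM a (curv g j l) y + conn g a y * curv g j l y - curv g j l y * conn g a y) *
        (g y)⁻¹) i k - ∑ m, conn g a y m j * S m l i k - ∑ m, conn g a y m l * S j m i k := by
    intro a j l
    have e1 : pd a (raise34 g (riemLow g) j l i k) y =
        (pdM a (fun z ↦ curv g j l z * (g z)⁻¹) y) i k :=
      pd_congr a hg.isOpen hy fun z hz ↦ hg.raise34_riemLow hz j l i k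
    have e2 : ∑ m, conn g a y k m * S j l i m = (S j l * (conn g a y)ᵀ) i k := by
      rw [Matrix.mul_apply]
      exact Finset.sum_congr rfl fun m _ ↦ mul_comm _ _
    have e3 : (pdM a (curv g j l) y + conn g a y * curv g j l y - curv g j l y * conn g a y) *
        (g y)⁻¹ = pdM a (curv g j l) y * (g y)⁻¹ +
          curv g j l y * -(conn g a y * (g y)⁻¹ + (g y)⁻¹ * (conn g a y)ᵀ) +
          conn g a y * S j l + S j l * (conn g a y)ᵀ := by
      rw [hS]
      noncomm_ring
    rw [hV]
    beta_reduce
    simp only [hg.raise34_riemLow hy]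
    rw [e1, pdM_mul a hg.isOpen hy (hg.smooth_curv j l) hg.smooth_inv, hg.pdM_inv hy, e3, e2,
      ← Matrix.mul_apply]
    simp only [Matrix.add_apply]
    ring
  have hanti : ∀ j l, S j l i k = -S l j i k := by
    intro j l
    rw [hS]
    beta_reduce
    rw [curv_antisymm, neg_mul, Matrix.neg_apply]
  have hconn : ∀ a m j, conn g a y m j = conn g j y m a := fun a m j ↦
    hg.christoffel_symm hy m a j
  have h2 := congr_fun (congr_fun (congr_arg (fun M : Matrix (Fin n) (Fin n) ℝ ↦ M * (g y)⁻¹)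
    (hg.bianchi_second hy a j l)) i) k
  -- the Christoffel symbols acting on the differentiated slots drop out, because the connection is
  -- torsion-free and the curvature antisymmetric
  have h3 : ∑ m, conn g a y m j * S m l i k + ∑ m, conn g a y m l * S j m i k +
      (∑ m, conn g j y m l * S m a i k + ∑ m, conn g j y m a * S l m i k) +
      (∑ m, conn g l y m a * S m j i k + ∑ m, conn g l y m j * S a m i k) = 0 := by
    simp only [← Finset.sum_add_distrib]
    refine Finset.sum_eq_zero fun m _ ↦ ?_
    rw [hconn j m a, hconn l m a, hconn l m j, hanti m l, hanti m a, hanti m j]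
    ring
  rw [h1, h1, h1]
  simp only [add_mul, sub_mul, zero_mul, Matrix.add_apply, Matrix.sub_apply,
    Matrix.zero_apply] at h2 ⊢
  linarith

/-- The decomposition of the Riemann tensor with the last two indices raised. -/
theorem raise34_riemLow_eq_add (hg : IsMetricOn g U) (hy : y ∈ U) (j l i k : Fin n) :
    raise34 g (riemLow g) j l i k y =
      raise34 g (weylLow g) j l i k y + knProd (fun j i ↦ schoutenUp g j i y) j l i k := by
  have hδ : ∀ i l, ∑ p, (g y)⁻¹ i p * g y l p = if l = i then 1 else 0 := by
    intro i l
    have := congr_fun (congr_fun (hg.inv_mul hy) i) l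
    rw [Matrix.mul_apply, Matrix.one_apply] at this
    simp only [eq_comm (a := l), ← this]
    exact Finset.sum_congr rfl fun p _ ↦ by rw [(hg.isSymm y hy).apply]
  have hprod : ∀ A B : Fin n → ℝ, ∑ p, ∑ q, (g y)⁻¹ i p * (g y)⁻¹ k q * (A p * B q) =
      (∑ p, (g y)⁻¹ i p * A p) * ∑ q, (g y)⁻¹ k q * B q := by
    intro A B
    rw [Finset.sum_mul_sum]
    exact Finset.sum_congr rfl fun p _ ↦ Finset.sum_congr rfl fun q _ ↦ by ring
  have h1 : raise34 g (riemLow g) j l i k y = raise34 g (weylLow g) j l i k y +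
      ∑ p, ∑ q, ((g y)⁻¹ i p * (g y)⁻¹ k q * (schouten g j p y * g y l q) -
        (g y)⁻¹ i p * (g y)⁻¹ k q * (g y l p * schouten g j q y) +
        (g y)⁻¹ i p * (g y)⁻¹ k q * (g y j p * schouten g l q y) -
        (g y)⁻¹ i p * (g y)⁻¹ k q * (schouten g l p y * g y j q)) := by
    simp only [raise34, ← Finset.sum_add_distrib]
    refine Finset.sum_congr rfl fun p _ ↦ Finset.sum_congr rfl fun q _ ↦ ?_
    rw [weylLow]
    ring
  rw [h1]
  simp only [Finset.sum_add_distrib, Finset.sum_sub_distrib, hprod, hδ, knProd, schoutenUp]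
  ring

end IsMetricOn

/-! ### The curvature tensors as polynomials -/

/-- The Riemann tensor `R_{ij}{}^{kl}` as a polynomial. -/
def riemElt (g : EuclideanSpace ℝ (Fin n) → Matrix (Fin n) (Fin n) ℝ)
    (y : EuclideanSpace ℝ (Fin n)) : MvPolynomial (Fin n × Fin n) ℝ :=
  elt4 fun j l i k ↦ raise34 g (riemLow g) j l i k y

/-- The Weyl tensor `W_{ij}{}^{kl}` as a polynomial. -/
def weylElt (g : EuclideanSpace ℝ (Fin n) → Matrix (Fin n) (Fin n) ℝ)
    (y : EuclideanSpace ℝ (Fin n)) : MvPolynomial (Fin n × Fin n) ℝ :=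
  elt4 fun j l i k ↦ raise34 g (weylLow g) j l i k y

/-- The Schouten tensor `P_j^i` as a polynomial. -/
def schoutenElt (g : EuclideanSpace ℝ (Fin n) → Matrix (Fin n) (Fin n) ℝ)
    (y : EuclideanSpace ℝ (Fin n)) : MvPolynomial (Fin n × Fin n) ℝ :=
  elt2 fun j i ↦ schoutenUp g j i y

/-- The Cotton tensor `C_{jl}{}^k` as a polynomial with a free lower index `i`. -/
def cottonElt (g : EuclideanSpace ℝ (Fin n) → Matrix (Fin n) (Fin n) ℝ)
    (y : EuclideanSpace ℝ (Fin n)) (i : Fin n) : MvPolynomial (Fin n × Fin n) ℝ :=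
  elt3 (fun j l k ↦ cottonUp g j l k y) i

/-- The covariant derivative `∇_a W_{ij}{}^{kl}` as a polynomial. -/
def covWeylElt (g : EuclideanSpace ℝ (Fin n) → Matrix (Fin n) (Fin n) ℝ)
    (y : EuclideanSpace ℝ (Fin n)) (a : Fin n) : MvPolynomial (Fin n × Fin n) ℝ :=
  (elt4 fun j l i k ↦ pd a (raise34 g (weylLow g) j l i k) y) + glDer (conn g a y) (weylElt g y)

/-- The covariant derivative `∇_a P_j^i` as a polynomial. -/
def covSchoutenElt (g : EuclideanSpace ℝ (Fin n) → Matrix (Fin n) (Fin n) ℝ)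
    (y : EuclideanSpace ℝ (Fin n)) (a : Fin n) : MvPolynomial (Fin n × Fin n) ℝ :=
  (elt2 fun j i ↦ pd a (schoutenUp g j i) y) + glDer (conn g a y) (schoutenElt g y)

/-- The covariant derivative `∇_a R_{ij}{}^{kl}` as a polynomial. -/
def covRiemElt (g : EuclideanSpace ℝ (Fin n) → Matrix (Fin n) (Fin n) ℝ)
    (y : EuclideanSpace ℝ (Fin n)) (a : Fin n) : MvPolynomial (Fin n × Fin n) ℝ :=
  (elt4 fun j l i k ↦ pd a (raise34 g (riemLow g) j l i k) y) + glDer (conn g a y) (riemElt g y)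

/-- The matrix of the mixed tensor `Ω_i^j`. -/
def omegaMat (g : EuclideanSpace ℝ (Fin n) → Matrix (Fin n) (Fin n) ℝ) (k : ℕ)
    (y : EuclideanSpace ℝ (Fin n)) : Matrix (Fin n) (Fin n) ℝ :=
  Matrix.of fun i j ↦ omegaMixed g k i j y

/-- The matrix of the mixed tensor `(tf Ω)_i^j`. -/
def tracefreeOmegaMat (g : EuclideanSpace ℝ (Fin n) → Matrix (Fin n) (Fin n) ℝ)
    (k : ℕ) (y : EuclideanSpace ℝ (Fin n)) : Matrix (Fin n) (Fin n) ℝ :=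
  omegaMat g k y - Matrix.scalar (Fin n) (1 / (n : ℝ) * trace2 g (omega g k) y)

variable (g : EuclideanSpace ℝ (Fin n) → Matrix (Fin n) (Fin n) ℝ)

theorem omegaMixed_eq (k : ℕ) (i j : Fin n) (y : EuclideanSpace ℝ (Fin n)) :
    omegaMixed g k i j y =
      deltaFun n (X (i, j) * omegaElt k (weylElt g y) (schoutenElt g y)) := by
  rw [omegaElt, Finset.mul_sum, map_sum]
  refine Finset.sum_congr rfl fun l _ ↦ ?_
  rw [mul_smul_comm, map_smul, smul_eq_mul, weylElt, schoutenElt,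
    deltaFun_X_mul_elt4_pow_mul_elt2_pow]

theorem pf_riem_eq (k : ℕ) (y : EuclideanSpace ℝ (Fin n)) :
    pf k (raise34 g (riemLow g)) y = 1 / (k.factorial : ℝ) * deltaFun n (riemElt g y ^ k) := by
  rw [riemElt, deltaFun_elt4_pow]; rfl

theorem pf_weyl_eq (k : ℕ) (y : EuclideanSpace ℝ (Fin n)) :
    pf k (raise34 g (weylLow g)) y = 1 / (k.factorial : ℝ) * deltaFun n (weylElt g y ^ k) := by
  rw [weylElt, deltaFun_elt4_pow]; rfl

theorem xi_eq (k : ℕ) (i : Fin n) (y : EuclideanSpace ℝ (Fin n)) :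
    xi g k i y = 1 / (k.factorial : ℝ) *
      deltaFun n (cottonElt g y i * weylElt g y ^ (k - 1)) +
      1 / (2 * (n : ℝ) * (k : ℝ)) * pd i (pf k (raise34 g (weylLow g))) y := by
  have hX : ∀ j l m, (X (i, j) * X (m, l) : MvPolynomial (Fin n × Fin n) ℝ) =
      ∏ a : Fin 2, X ((![i, m] : Fin 2 → Fin n) a, (![j, l] : Fin 2 → Fin n) a) := by
    intro j l m
    simp
  rw [xi]
  congr 2
  rw [cottonElt, elt3, Finset.sum_mul, map_sum]
  refine Finset.sum_congr rfl fun j _ ↦ ?_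
  rw [Finset.sum_comm, Finset.sum_mul, map_sum]
  refine Finset.sum_congr rfl fun l _ ↦ ?_
  rw [Finset.sum_mul, map_sum]
  refine Finset.sum_congr rfl fun m _ ↦ ?_
  rw [smul_mul_assoc, map_smul, hX, weylElt, deltaFun_prod_mul_elt4_pow, smul_eq_mul,
    Finset.mul_sum]
  refine Finset.sum_congr rfl fun I _ ↦ ?_
  rw [Finset.mul_sum]
  refine Finset.sum_congr rfl fun J _ ↦ ?_
  ring

/-! ### The divergence of `Ω` -/

namespace IsMetricOn

variable {g} {U : Set (EuclideanSpace ℝ (Fin n))} {y : EuclideanSpace ℝ (Fin n)}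

theorem riemElt_eq_add (hg : IsMetricOn g U) (hy : y ∈ U) :
    riemElt g y = weylElt g y + elt4 (knProd fun j i ↦ schoutenUp g j i y) := by
  rw [riemElt, weylElt, ← elt4_add]
  simp only [hg.raise34_riemLow_eq_add hy]

/-- Under the delta, `Rm = W + 4 P θ` with the identity `θ`. -/
theorem deltaMk_riemElt (hg : IsMetricOn g U) (hy : y ∈ U) :
    deltaMk n (riemElt g y) =
      deltaMk n (weylElt g y + 4 * schoutenElt g y * idElt n) := by
  rw [hg.riemElt_eq_add hy, map_add, deltaMk_elt4_knProd, ← map_add, schoutenElt]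

theorem differentiableAt_weyl (hg : IsMetricOn g U) (hy : y ∈ U) (j l i k : Fin n) :
    DifferentiableAt ℝ (raise34 g (weylLow g) j l i k) y :=
  differentiableAt_of_contDiffOn hg.isOpen (hg.contDiffOn_raise34 hg.contDiffOn_weylLow j l i k) hy

theorem differentiableAt_schouten (hg : IsMetricOn g U) (hy : y ∈ U) (j i : Fin n) :
    DifferentiableAt ℝ (schoutenUp g j i) y :=
  differentiableAt_of_contDiffOn hg.isOpen (hg.contDiffOn_schoutenUp j i) hy

theorem deltaMk_covRiemElt (hg : IsMetricOn g U) (hy : y ∈ U) (a : Fin n) :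
    deltaMk n (covRiemElt g y a) =
      deltaMk n (covWeylElt g y a + 4 * covSchoutenElt g y a * idElt n) := by
  have hP := hg.differentiableAt_schouten hy
  have h1 : ∀ j l i k, pd a (raise34 g (riemLow g) j l i k) y =
      pd a (raise34 g (weylLow g) j l i k) y +
        knProd (fun j i ↦ pd a (schoutenUp g j i) y) j l i k := by
    intro j l i k
    rw [pd_congr a hg.isOpen hy fun z hz ↦ hg.raise34_riemLow_eq_add hz j l i k]
    have d1 := (hP j i).mul_const (if l = k then (1 : ℝ) else 0)
    have d2 := (hP j k).mul_const (if l = i then (1 : ℝ) else 0)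
    have d3 := (hP l k).mul_const (if j = i then (1 : ℝ) else 0)
    have d4 := (hP l i).mul_const (if j = k then (1 : ℝ) else 0)
    have hc : ∀ (f : EuclideanSpace ℝ (Fin n) → ℝ) (c : ℝ), DifferentiableAt ℝ f y →
        pd a (fun z ↦ f z * c) y = pd a f y * c := fun f c hf ↦ by
      rw [pd_mul a hf (differentiableAt_const _), pd_const, mul_zero, add_zero]
    unfold knProd
    rw [pd_add a (hg.differentiableAt_weyl hy j l i k) (((d1.fun_sub d2).fun_add d3).fun_sub d4),
      pd_sub a ((d1.fun_sub d2).fun_add d3) d4, pd_add a (d1.fun_sub d2) d3, pd_sub a d1 d2,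
      hc _ _ (hP j i), hc _ _ (hP j k), hc _ _ (hP l k), hc _ _ (hP l i)]
  have h2 : deltaMk n (glDer (conn g a y) (riemElt g y)) =
      deltaMk n (glDer (conn g a y) (weylElt g y) +
        4 * glDer (conn g a y) (schoutenElt g y) * idElt n) := by
    rw [deltaMk_glDer_congr _ (hg.deltaMk_riemElt hy), map_add, Derivation.leibniz,
      Derivation.leibniz, glDer_idElt]
    have : glDer (conn g a y) (4 : MvPolynomial (Fin n × Fin n) ℝ) = 0 := by
      have := (glDer (conn g a y)).map_natCast 4
      exact_mod_cast this
    rw [this]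
    congr 1
    simp only [smul_eq_mul, mul_zero, add_zero, zero_add]
    ring
  rw [covRiemElt, map_add, h2]
  simp only [h1]
  rw [elt4_add, map_add, deltaMk_elt4_knProd, ← map_add, ← map_add, covWeylElt, covSchoutenElt]
  congr 1
  ring

/-- The second Bianchi identity under the delta. -/
theorem deltaMk_sum_X_mul_covRiemElt (hg : IsMetricOn g U) (hy : y ∈ U) (i : Fin n) :
    deltaMk n (∑ j, X (i, j) * covRiemElt g y j) = 0 := by
  simp only [covRiemElt, riemElt, glDer_elt4, ← elt4_add]
  exact deltaMk_sum_X_mul_elt4_eq_zero _ (hg.bianchi_second_raised hy rfl) i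

theorem deltaMk_two_mul_sum_X_mul_covSchoutenElt (hg : IsMetricOn g U) (hy : y ∈ U) (i : Fin n) :
    deltaMk n (2 * ∑ j, X (i, j) * covSchoutenElt g y j) = deltaMk n (cottonElt g y i) := by
  simp only [covSchoutenElt, schoutenElt, glDer_elt2, ← elt2_add, hg.covariant_schoutenUp hy]
  rw [deltaMk_two_mul_sum_X_mul_elt2]
  simp only [← Finset.sum_sub_distrib, ← mul_sub]
  rfl

/-- The contracted form of `∇W`: by the second Bianchi identity for `Rm`, only the derivatives of the
Schouten tensor remain. -/
theorem deltaMk_sum_X_mul_covWeylElt (hg : IsMetricOn g U) (hy : y ∈ U) (i : Fin n) :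
    deltaMk n (∑ j, X (i, j) * covWeylElt g y j) =
      deltaMk n (-2 * cottonElt g y i * idElt n) := by
  have h1 : deltaMk n (∑ j, X (i, j) * covRiemElt g y j) =
      deltaMk n (∑ j, X (i, j) * covWeylElt g y j +
        2 * (2 * ∑ j, X (i, j) * covSchoutenElt g y j) * idElt n) := by
    have : ∑ j, X (i, j) * covWeylElt g y j +
        2 * (2 * ∑ j, X (i, j) * covSchoutenElt g y j) * idElt n =
        ∑ j, X (i, j) * (covWeylElt g y j + 4 * covSchoutenElt g y j * idElt n) := by
      simp only [Finset.mul_sum, Finset.sum_mul, ← Finset.sum_add_distrib]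
      exact Finset.sum_congr rfl fun j _ ↦ by ring
    rw [this]
    exact deltaMk_sum_congr fun j _ ↦ by rw [map_mul, map_mul, hg.deltaMk_covRiemElt hy]
  rw [hg.deltaMk_sum_X_mul_covRiemElt hy, map_add, map_mul, map_mul,
    hg.deltaMk_two_mul_sum_X_mul_covSchoutenElt hy] at h1
  simp only [map_mul, map_neg, map_ofNat] at h1 ⊢
  linear_combination -h1

theorem contDiffOn_omegaMixed (hg : IsMetricOn g U) (k : ℕ) (i j : Fin n) :
    ContDiffOn ℝ ∞ (omegaMixed g k i j) U :=
  ContDiffOn.sum fun _ _ ↦ contDiffOn_const.mul <| ContDiffOn.sum fun _ _ ↦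
    ContDiffOn.sum fun _ _ ↦ (contDiffOn_const.mul (contDiffOn_prod fun _ _ ↦
      hg.contDiffOn_raise34 hg.contDiffOn_weylLow _ _ _ _)).mul (contDiffOn_prod fun _ _ ↦
        hg.contDiffOn_schoutenUp _ _)

theorem contDiffOn_omega (hg : IsMetricOn g U) (k : ℕ) (i j : Fin n) :
    ContDiffOn ℝ ∞ (omega g k i j) U :=
  ContDiffOn.sum fun m _ ↦ (hg.contDiffOn_omegaMixed k i m).mul (hg.smooth m j)

theorem contDiffOn_pf_weyl (hg : IsMetricOn g U) (k : ℕ) :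
    ContDiffOn ℝ ∞ (pf k (raise34 g (weylLow g))) U :=
  contDiffOn_const.mul <| ContDiffOn.sum fun _ _ ↦ ContDiffOn.sum fun _ _ ↦
    contDiffOn_const.mul (contDiffOn_prod fun _ _ ↦
      hg.contDiffOn_raise34 hg.contDiffOn_weylLow _ _ _ _)

theorem omega_symm (hg : IsMetricOn g U) (hy : y ∈ U) (k : ℕ) (i j : Fin n) :
    omega g k i j y = omega g k j i y := by
  simp only [omega, omegaMixed_eq]
  refine sum_deltaFun_mul_symm (hg.inv_mul hy) (hg.isSymm y hy) ?_ i j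
  have h1 : metricTranspose (g y) (g y)⁻¹ (weylElt g y) = weylElt g y :=
    metricTranspose_elt4_raise (hg.inv_mul hy) (hg.inv_isSymm hy) (hg.weylLow_pair_symm hy)
  have h2 : metricTranspose (g y) (g y)⁻¹ (schoutenElt g y) = schoutenElt g y :=
    metricTranspose_elt2_raise (hg.inv_mul hy) (hg.inv_isSymm hy) (hg.schouten_symm hy)
  simp only [omegaElt, map_sum, map_smul, map_mul, map_pow, h1, h2]

theorem smooth_omegaMat (hg : IsMetricOn g U) (k : ℕ) : SmoothMatOn (omegaMat g k) U :=
  hg.contDiffOn_omegaMixed k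

/-- The covariant derivative of `Ω_i^j` is obtained by differentiating its factors. -/
theorem covariant_omegaMat (hg : IsMetricOn g U) (hy : y ∈ U) (k : ℕ) (a i j : Fin n) :
    (pdM a (omegaMat g k) y + omegaMat g k y * (conn g a y)ᵀ -
      (conn g a y)ᵀ * omegaMat g k y) i j =
    deltaFun n (X (i, j) * omegaEltDeriv k (weylElt g y) (schoutenElt g y)
      (covWeylElt g y a) (covSchoutenElt g y a)) := by
  have h1 : pdM a (omegaMat g k) y i j = deltaFun n (X (i, j) *
      omegaEltDeriv k (weylElt g y) (schoutenElt g y)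
        (elt4 fun j l i k ↦ pd a (raise34 g (weylLow g) j l i k) y)
        (elt2 fun j i ↦ pd a (schoutenUp g j i) y)) := by
    have hw : HasPartial a (weylElt g) _ y := HasPartial.elt4 (hg.differentiableAt_weyl hy)
    have hp : HasPartial a (schoutenElt g) _ y := HasPartial.elt2 (hg.differentiableAt_schouten hy)
    have := (hw.omegaElt k hp).pd_linearMap
      ((deltaFun n).comp (LinearMap.mulLeft ℝ (X (i, j))))
    simpa only [pdM, omegaMat, Matrix.of_apply, omegaMixed_eq, LinearMap.comp_apply,
      LinearMap.mulLeft_apply] using this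
  have h2 := deltaFun_mul_glDer (conn g a y) (X (i, j))
    (omegaElt k (weylElt g y) (schoutenElt g y))
  rw [derivation_omegaElt, glDer_X, Finset.mul_sum, map_sum] at h2
  simp only [mul_comm (omegaElt k _ _), sub_mul, smul_mul_assoc, map_sub, map_smul, smul_eq_mul,
    ← omegaMixed_eq, Finset.sum_sub_distrib] at h2
  rw [covWeylElt, covSchoutenElt, omegaEltDeriv_add, mul_add, map_add, h2, ← h1]
  simp only [Matrix.add_apply, Matrix.sub_apply, Matrix.mul_apply, Matrix.transpose_apply,
    omegaMat, Matrix.of_apply, mul_comm (omegaMixed g k _ _ y)]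
  ring

/-- The divergence of a tensor `O_i^m g_{mj}` in terms of the mixed tensor `O`. -/
theorem div2_mul_metric (hg : IsMetricOn g U) (hy : y ∈ U)
    {O : EuclideanSpace ℝ (Fin n) → Matrix (Fin n) (Fin n) ℝ} (hO : SmoothMatOn O U) (i : Fin n) :
    div2 g (fun i j z ↦ (O z * g z) i j) i y =
      ∑ a, (pdM a O y + O y * (conn g a y)ᵀ - (conn g a y)ᵀ * O y) i a := by
  have h1 : ∀ a j, cov2 g (fun i j z ↦ (O z * g z) i j) a i j y =
      ((pdM a O y + O y * (conn g a y)ᵀ - (conn g a y)ᵀ * O y) * g y) i j := by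
    intro a j
    have e1 : pd a (fun z ↦ (O z * g z) i j) y =
        (pdM a O y * g y + O y * ((conn g a y)ᵀ * g y + g y * conn g a y)) i j := by
      rw [← hg.pdM_metric hy, ← pdM_mul a hg.isOpen hy hO hg.smooth]
      rfl
    have e2 : ∑ m, christoffel g m a i y * (O y * g y) m j =
        ((conn g a y)ᵀ * (O y * g y)) i j := by
      rw [Matrix.mul_apply (M := (conn g a y)ᵀ)]; rfl
    have e3 : ∑ m, christoffel g m a j y * (O y * g y) i m = ((O y * g y) * conn g a y) i j := by
      rw [Matrix.mul_apply (N := conn g a y)]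
      exact Finset.sum_congr rfl fun m _ ↦ mul_comm _ _
    rw [cov2, e1, e2, e3, ← Matrix.sub_apply, ← Matrix.sub_apply]
    simp only [mul_add, add_mul, sub_mul, mul_assoc, Matrix.add_apply, Matrix.sub_apply]
    ring
  rw [div2, Finset.sum_comm]
  refine Finset.sum_congr rfl fun a _ ↦ ?_
  set K := pdM a O y + O y * (conn g a y)ᵀ - (conn g a y)ᵀ * O y with hK
  have h2 : K i a = (K * g y * (g y)⁻¹) i a := by
    rw [mul_assoc, hg.mul_inv hy, mul_one]
  rw [h2, Matrix.mul_apply]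
  refine Finset.sum_congr rfl fun j _ ↦ ?_
  rw [h1, mul_comm]

theorem trace2_mul_metric (hg : IsMetricOn g U) (hy : y ∈ U)
    (O : EuclideanSpace ℝ (Fin n) → Matrix (Fin n) (Fin n) ℝ) :
    trace2 g (fun i j z ↦ (O z * g z) i j) y = (O y).trace := by
  have h : O y = O y * g y * (g y)⁻¹ := by rw [mul_assoc, hg.mul_inv hy, mul_one]
  conv_rhs => rw [h]
  rw [trace2, Matrix.trace]
  refine Finset.sum_congr rfl fun i _ ↦ ?_
  rw [Matrix.diag_apply, Matrix.mul_apply]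
  refine Finset.sum_congr rfl fun j _ ↦ ?_
  rw [(hg.inv_isSymm hy).apply, mul_comm]

theorem omega_eq (k : ℕ) : omega g k = fun i j z ↦ (omegaMat g k z * g z) i j := by
  ext i j z
  rw [Matrix.mul_apply]; rfl

theorem tracefree_omega_eq (k : ℕ) :
    tracefree g (omega g k) = fun i j z ↦ (tracefreeOmegaMat g k z * g z) i j := by
  ext i j z
  rw [tracefreeOmegaMat, sub_mul, Matrix.sub_apply, tracefree, omega_eq, Matrix.scalar_apply,
    Matrix.diagonal_mul]

theorem trace2_omega (hg : IsMetricOn g U) (hy : y ∈ U) (k : ℕ) :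
    trace2 g (omega g k) y = ∑ i, omegaMixed g k i i y := by
  rw [omega_eq, hg.trace2_mul_metric hy]
  rfl

theorem trace2_tracefree_omega (hg : IsMetricOn g U) (hy : y ∈ U) (hn : n ≠ 0) (k : ℕ) :
    trace2 g (tracefree g (omega g k)) y = 0 := by
  have hn' : (n : ℝ) ≠ 0 := by exact_mod_cast hn
  rw [tracefree_omega_eq, hg.trace2_mul_metric hy, tracefreeOmegaMat, Matrix.trace_sub,
    hg.trace2_omega hy, Matrix.scalar_apply, Matrix.trace_diagonal, Finset.sum_const,
    Finset.card_univ, Fintype.card_fin, nsmul_eq_mul]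
  have : (omegaMat g k y).trace = ∑ i, omegaMixed g k i i y := rfl
  rw [this]
  field_simp
  ring

theorem contDiffOn_trace_omega (hg : IsMetricOn g U) (k : ℕ) :
    ContDiffOn ℝ ∞ (trace2 g (omega g k)) U :=
  ContDiffOn.sum fun i _ ↦ ContDiffOn.sum fun j _ ↦
    (hg.smooth_inv i j).mul (hg.contDiffOn_omega k i j)

theorem div2_tracefree_omega (hg : IsMetricOn g U) (hy : y ∈ U) (k : ℕ) (i : Fin n) :
    div2 g (tracefree g (omega g k)) i y =
      ∑ a, (pdM a (omegaMat g k) y + omegaMat g k y * (conn g a y)ᵀ -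
        (conn g a y)ᵀ * omegaMat g k y) i a -
      1 / (n : ℝ) * pd i (trace2 g (omega g k)) y := by
  have hf := hg.contDiffOn_trace_omega k
  set f : EuclideanSpace ℝ (Fin n) → ℝ := fun z ↦ 1 / (n : ℝ) * trace2 g (omega g k) z with hfdef
  have hfd : ContDiffOn ℝ ∞ f U := contDiffOn_const.mul hf
  have hs : SmoothMatOn (fun z ↦ Matrix.scalar (Fin n) (f z)) U := by
    intro p q
    simp only [Matrix.scalar_apply, Matrix.diagonal_apply]
    split_ifs
    · exact hfd
    · exact contDiffOn_const
  have hO : SmoothMatOn (tracefreeOmegaMat g k) U := (hg.smooth_omegaMat k).sub hs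
  have hpd : ∀ a, pdM a (tracefreeOmegaMat g k) y =
      pdM a (omegaMat g k) y - Matrix.scalar (Fin n) (pd a f y) := by
    intro a
    have e : pdM a (fun z ↦ Matrix.scalar (Fin n) (f z)) y = Matrix.scalar (Fin n) (pd a f y) := by
      ext p q
      simp only [pdM, Matrix.of_apply, Matrix.scalar_apply, Matrix.diagonal_apply]
      split_ifs
      · rfl
      · exact pd_const a 0
    rw [← e]
    exact pdM_sub a hg.isOpen hy (hg.smooth_omegaMat k) hs
  have hK : ∀ a, pdM a (tracefreeOmegaMat g k) y + tracefreeOmegaMat g k y * (conn g a y)ᵀ -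
      (conn g a y)ᵀ * tracefreeOmegaMat g k y =
      (pdM a (omegaMat g k) y + omegaMat g k y * (conn g a y)ᵀ -
        (conn g a y)ᵀ * omegaMat g k y) - Matrix.scalar (Fin n) (pd a f y) := by
    intro a
    have hc := Matrix.scalar_commute (n := Fin n) (f y) (fun r ↦ Commute.all _ _) (conn g a y)ᵀ
    have hT : tracefreeOmegaMat g k y = omegaMat g k y - Matrix.scalar (Fin n) (f y) := rfl
    rw [hpd, hT, sub_mul, mul_sub, hc.eq]
    abel
  rw [tracefree_omega_eq, hg.div2_mul_metric hy hO]
  simp only [hK, Matrix.sub_apply _ (Matrix.scalar (Fin n) _), Finset.sum_sub_distrib]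
  congr 1
  simp only [Matrix.scalar_apply, Matrix.diagonal_apply, Finset.sum_ite_eq, Finset.mem_univ,
    if_true]
  rw [hfdef, pd_const_mul i _ (differentiableAt_of_contDiffOn hg.isOpen hf hy)]

/-- In dimension `2k`, the Pfaffians of `Rm` and `W` differ by the trace of `Ω`. -/
theorem pf_riem_eq_add (hg : IsMetricOn g U) (hy : y ∈ U) {k : ℕ} (hn : n = 2 * k) :
    pf k (raise34 g (riemLow g)) y =
      pf k (raise34 g (weylLow g)) y + trace2 g (omega g k) y := by
  rw [pf_riem_eq, pf_weyl_eq, hg.trace2_omega hy, deltaFun_pow_eq_add_trace hn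
    (isHomogeneous_elt4 _) (isHomogeneous_elt2 _) (hg.deltaMk_riemElt hy)]
  simp only [omegaMixed_eq]
  rfl

/-- The divergence of `tf Ω` contributes the Cotton term of `2k ξ` and `-(1/n) ∇ tr Ω`; the latter
turns `(1/2k) ∇ Pf(Rm)` into `(1/2k) ∇ Pf(W)`. -/
theorem two_mul_xi (hg : IsMetricOn g U) (hy : y ∈ U) {k : ℕ} (hk : k ≠ 0) (hn : n = 2 * k)
    (i : Fin n) :
    2 * (k : ℝ) * xi g k i y = div2 g (tracefree g (omega g k)) i y +
      1 / (2 * (k : ℝ)) * pd i (pf k (raise34 g (riemLow g))) y := by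
  have hk' : (k : ℝ) ≠ 0 := by exact_mod_cast hk
  have hn' : (n : ℝ) = 2 * k := by exact_mod_cast hn
  have h1 : pd i (pf k (raise34 g (riemLow g))) y =
      pd i (pf k (raise34 g (weylLow g))) y + pd i (trace2 g (omega g k)) y := by
    rw [pd_congr i hg.isOpen hy fun z hz ↦ hg.pf_riem_eq_add hz hn, pd_add i
      (differentiableAt_of_contDiffOn hg.isOpen (hg.contDiffOn_pf_weyl k) hy)
      (differentiableAt_of_contDiffOn hg.isOpen (hg.contDiffOn_trace_omega k) hy)]
  rw [hg.div2_tracefree_omega hy, h1, xi_eq, hn']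
  simp only [hg.covariant_omegaMat hy]
  have h3 : ∑ j, deltaFun n (X (i, j) * omegaEltDeriv k (weylElt g y) (schoutenElt g y)
      (covWeylElt g y j) (covSchoutenElt g y j)) = 2 * k * (1 / (k.factorial : ℝ) *
        deltaFun n (cottonElt g y i * weylElt g y ^ (k - 1))) :=
    sum_deltaFun_X_mul_omegaEltDeriv hn i (isHomogeneous_elt4 _) (isHomogeneous_elt2 _)
      (isHomogeneous_elt3 _ i) (hg.deltaMk_sum_X_mul_covWeylElt hy i)
      (hg.deltaMk_two_mul_sum_X_mul_covSchoutenElt hy i)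
  rw [h3]
  field_simp
  ring

end IsMetricOn

end Coord

/-! ### The metric in a chart -/

/-- The Gram matrix of a bilinear form without right kernel is nonsingular. -/
theorem det_bilin_ne_zero {n : ℕ}
    (B : EuclideanSpace ℝ (Fin n) →L[ℝ] EuclideanSpace ℝ (Fin n) →L[ℝ] ℝ)
    (h : ∀ v, (∀ u, B u v = 0) → v = 0) :
    (Matrix.of fun i j ↦ B (EuclideanSpace.single i (1 : ℝ))
      (EuclideanSpace.single j (1 : ℝ))).det ≠ 0 := by
  have hsum (u : EuclideanSpace ℝ (Fin n)) : u = ∑ j, u j • EuclideanSpace.single j (1 : ℝ) := by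
    ext k
    simp [Finset.sum_apply, Pi.single_apply]
  intro hdet
  obtain ⟨v, hv, hv0⟩ := Matrix.exists_mulVec_eq_zero_iff.2 hdet
  have h1 (i : Fin n) : B (EuclideanSpace.single i (1 : ℝ)) (WithLp.toLp 2 v) = 0 := by
    rw [hsum (WithLp.toLp 2 v), map_sum]
    simpa [Matrix.mulVec, dotProduct, mul_comm] using congr_fun hv0 i
  refine hv (congr_arg WithLp.ofLp (h (WithLp.toLp 2 v) fun u ↦ ?_))
  rw [hsum u, map_sum, _root_.sum_apply]
  exact Finset.sum_eq_zero fun i _ ↦ by simp [h1]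

namespace PseudoRiemannianMetric

variable {n : ℕ} {M : Type*} [TopologicalSpace M]
  [ChartedSpace (EuclideanSpace ℝ (Fin n)) M] [IsManifold (𝓡 n) ∞ M]
  (g : PseudoRiemannianMetric n M) {e : OpenPartialHomeomorph M (EuclideanSpace ℝ (Fin n))}

/-- The vector fields on the domain of a chart with constant components, viewed as functions of the
coordinates, are smooth. -/
theorem contMDiffOn_mfderiv_symm (he : e ∈ IsManifold.maximalAtlas (𝓡 n) ∞ M)
    (v : EuclideanSpace ℝ (Fin n)) :
    ContMDiffOn (𝓡 n) (𝓡 n).tangent ∞ (fun y ↦ (Bundle.TotalSpace.mk' (EuclideanSpace ℝ (Fin n))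
      (e.symm y) (mfderiv (𝓡 n) (𝓡 n) e.symm y v) : TangentBundle (𝓡 n) M)) e.target := by
  have h1 := (contMDiffOn_symm_of_mem_maximalAtlas he).contMDiffOn_tangentMapWithin
    (m := ∞) (by simp) e.open_target.uniqueMDiffOn
  have h2 : ContMDiffOn (𝓡 n) (𝓡 n).tangent ∞ (fun y ↦ (Bundle.TotalSpace.mk'
      (EuclideanSpace ℝ (Fin n)) y v : TangentBundle (𝓡 n) (EuclideanSpace ℝ (Fin n))))
      e.target :=
    contMDiffOn_vectorSpace_iff_contDiffOn.2 contDiffOn_const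
  refine (h1.comp h2 fun y hy ↦ hy).congr fun y hy ↦ ?_
  simp only [Function.comp_apply, tangentMapWithin]
  rw [mfderivWithin_of_isOpen e.open_target hy]

theorem contDiffOn_inChart (he : e ∈ IsManifold.maximalAtlas (𝓡 n) ∞ M) (i j : Fin n) :
    ContDiffOn ℝ ∞ (fun y ↦ g.inChart e y i j) e.target := by
  rw [← contMDiffOn_iff_contDiffOn]
  intro y hy
  have h : ContMDiffWithinAt (𝓡 n) ((𝓡 n).prod 𝓘(ℝ)) ∞
      (fun y ↦ Bundle.TotalSpace.mk' ℝ (E := Bundle.Trivial M ℝ) (e.symm y)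
        (g.inner (e.symm y) (mfderiv (𝓡 n) (𝓡 n) e.symm y (EuclideanSpace.single i (1 : ℝ)))
          (mfderiv (𝓡 n) (𝓡 n) e.symm y (EuclideanSpace.single j (1 : ℝ))))) e.target y := by
    apply ContMDiffWithinAt.clm_bundle_apply₂ (F₁ := EuclideanSpace ℝ (Fin n))
      (F₂ := EuclideanSpace ℝ (Fin n))
    · exact ContMDiffAt.comp_contMDiffWithinAt y g.contMDiff.contMDiffAt
        (contMDiffOn_symm_of_mem_maximalAtlas he y hy)
    · exact contMDiffOn_mfderiv_symm he _ y hy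
    · exact contMDiffOn_mfderiv_symm he _ y hy
  simp only [Bundle.contMDiffWithinAt_totalSpace] at h
  exact h.2

theorem det_inChart_ne_zero (he : e ∈ IsManifold.maximalAtlas (𝓡 n) ∞ M)
    {y : EuclideanSpace ℝ (Fin n)} (hy : y ∈ e.target) : (g.inChart e y).det ≠ 0 := by
  have hd : e.MDifferentiable (𝓡 n) (𝓡 n) :=
    ⟨(contMDiffOn_of_mem_maximalAtlas he).mdifferentiableOn (by simp),
      (contMDiffOn_symm_of_mem_maximalAtlas he).mdifferentiableOn (by simp)⟩
  have hbij := hd.symm.mfderiv_bijective hy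
  -- the tangent spaces are copies of the model space, so this is a bilinear form on the latter
  let D : EuclideanSpace ℝ (Fin n) →L[ℝ] EuclideanSpace ℝ (Fin n) :=
    mfderiv (𝓡 n) (𝓡 n) e.symm y
  let B : EuclideanSpace ℝ (Fin n) →L[ℝ] EuclideanSpace ℝ (Fin n) →L[ℝ] ℝ := g.inner (e.symm y)
  refine det_bilin_ne_zero (B.bilinearComp D D) fun v hv ↦ hbij.1 ?_
  refine (g.nondegenerate _ _ fun u ↦ ?_).trans (map_zero (mfderiv (𝓡 n) (𝓡 n) e.symm y)).symm
  obtain ⟨u, rfl⟩ := hbij.2 u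
  exact (g.symm _ _ _).trans (hv u)

theorem isMetricOn_inChart (he : e ∈ IsManifold.maximalAtlas (𝓡 n) ∞ M) :
    Coord.IsMetricOn (g.inChart e) e.target where
  isOpen := e.open_target
  smooth := g.contDiffOn_inChart he
  isSymm _ _ := by
    ext i j
    exact g.symm _ _ _
  det_ne_zero _ hy := g.det_inChart_ne_zero he hy

end PseudoRiemannianMetric

end

theorem mainTheorem4 (k : ℕ) (hk : 2 ≤ k) {M : Type*} [TopologicalSpace M]
    [ChartedSpace (EuclideanSpace ℝ (Fin (2 * k))) M] [IsManifold (𝓡 (2 * k)) ∞ M]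
    (g : PseudoRiemannianMetric (2 * k) M)
    (e : OpenPartialHomeomorph M (EuclideanSpace ℝ (Fin (2 * k))))
    (he : e ∈ IsManifold.maximalAtlas (𝓡 (2 * k)) ∞ M) :
    -- the tensor `Ω_{ij}` is smooth and symmetric
    (∀ i j : Fin (2 * k), ContDiffOn ℝ ∞ (Coord.omega (g.inChart e) k i j) e.target) ∧
    ∀ y ∈ e.target,
      (∀ i j : Fin (2 * k),
        Coord.omega (g.inChart e) k i j y = Coord.omega (g.inChart e) k j i y) ∧
      -- the tensor `(tf Ω)_{ij}` is trace-free
      Coord.trace2 (g.inChart e)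
        (Coord.tracefree (g.inChart e) (Coord.omega (g.inChart e) k)) y = 0 ∧
      -- `2k ξ_i = ∇^j (tf Ω)_{ij} + (1 / (2k)) ∇_i Pf(Rm)`
      ∀ i : Fin (2 * k),
        2 * (k : ℝ) * Coord.xi (g.inChart e) k i y =
          Coord.div2 (g.inChart e)
            (Coord.tracefree (g.inChart e) (Coord.omega (g.inChart e) k)) i y
          + 1 / (2 * (k : ℝ)) * Coord.pd i
            (Coord.pf k (Coord.raise34 (g.inChart e) (Coord.riemLow (g.inChart e)))) y := by
  have hg := g.isMetricOn_inChart he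
  exact ⟨fun i j ↦ hg.contDiffOn_omega k i j, fun y hy ↦ ⟨hg.omega_symm hy k,
    hg.trace2_tracefree_omega hy (by omega) k, hg.two_mul_xi hy (by omega) rfl⟩⟩
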